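/- Let $p,q\ge 0$, $n=p+q$, and let $Cl_{p,q}$ be the real Clifford algebra generated by $\gamma_1,\dots,\gamma_n$ with $\gamma_i^2=1$ for $i\le p$, $\gamma_i^2=-1$ for $i>p$, and $\gamma_i\gamma_j=-\gamma_j\gamma_i$ for $i\ne j$. Write $\gamma_{i_1,\dots,i_r}=\gamma_{i_1}\cdots\gamma_{i_r}$, and $\gamma_X=\{\gamma_\alpha:\alpha\in X\}$ for a set $X$ of multi-indices. For $s,l\ge 0$ put $$B(s,l)=\bigcup_{i=0}^{l-1}\{(t_i+1,t_i+2,t_i+3,t_i+4),\ (t_i+1,t_i+2,t_i+5,t_i+6),\ (t_i+1,t_i+2,t_i+7,t_i+8),\ (t_i+1,t_i+3,t_i+5,t_i+7)\},\quad t_i=s+8i.$$ Let the Radon–Hurwitz numbers be given by $r_0=0$, $r_1=1$, $r_2=r_3=2$, $r_4=r_5=r_6=r_7=3$, $r_{i+8}=r_i+4$ for $i\ge0$, $r_{-1}=-1$, and $r_{-i}=1-i+r_{i-2}$ for $i\ge 2$. Every signature has the form $(p,p+8l+a)$ or $(q+8l+a,q)$ with $l\ge0$ and $0\le a\le 7$.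 Define a set $G\subset Cl_{p,q}$ and a number $k$ as follows. (1) Signature $(p,p+8l+a)$. Let $P_2=\{(i,p+i):1\le i\le p\}$, $P_4=B(2p,l)$, $m=2p+8l$, and $G=\gamma_{P_2}\cup\gamma_{P_4}\cup E$, where - $a=0,1,2$: $E=\emptyset$, $k=p+4l$; - $a=3$: $E=\{\gamma_{m+1,m+2,m+3}\}$, $k=p+4l+1$; - $a=4$: $E=\{\gamma_{m+1,m+2,m+3,m+4}\}$, $k=p+4l+1$; - $a=5$: $E=\{\gamma_{m+1,m+2,m+3,m+4},\gamma_{m+1,m+2,m+5}\}$, $k=p+4l+2$; - $a=6$: $E=\{\gamma_{m+1,m+2,m+4},\gamma_{m+2,m+3,m+5},\gamma_{m+3,m+4,m+6}\}$, $k=p+4l+3$; - $a=7$: $E=\{\gamma_{m+1,m+2,m+4},\gamma_{m+2,m+3,m+5},\gamma_{m+3,m+4,m+6},\gamma_{m+4,m+5,m+7}\}$, $k=p+4l+4$. (2) Signature $(q+8l+a,q)$. Let $Q_2=\{(i,q+8l+a+i):1\le i\le q\}$, $Q_4=B(q,l)$, $m=q+8l$, and $G=\gamma_{Q_2}\cup\gamma_{Q_4}\cup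 E$, where - $a=0$: $E=\emptyset$, $k=q+4l$; - $a=1,2,3,4$: $E=\{\gamma_{m+1}\}$, $k=q+4l+1$; - $a=5$: $E=\{\gamma_{m+1,m+2,m+3,m+4},\gamma_{m+5}\}$, $k=q+4l+2$; - $a=6$: $E=\{\gamma_{m+1,m+2,m+3,m+4},\gamma_{m+1,m+2,m+5,m+6}\}$, $k=q+4l+2$; - $a=7$: $E=\{\gamma_{m+1,m+2,m+3,m+4},\gamma_{m+1,m+2,m+5,m+6},\gamma_{m+7}\}$, $k=q+4l+3$. Then in every case, for the signature in question (denoted $(p,q)$ again, with $n=p+q$): $G$ consists of basis $1$-, $2$-, $3$- and $4$-vectors (products $\gamma_{i_1}\cdots\gamma_{i_r}$ with $1\le i_1<\dots<i_r\le n$) and has exactly $k=q-r_{q-p}$ elements, which are mutually commuting and square to $1$, and none of which is a product of other elements of $G$. The element $F=\prod_{g\in G}\frac{1+g}{2}$ is a primitive idempotent (a nonzero idempotent that is not the sum of two nonzero idempotents annihilating each other), and $Cl_{p,q}F$ is a minimal left ideal of real dimension $2^{n-k}$. -/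

import Mathlib

noncomputable section

namespace CliffordTables

/-- The quadratic form of `ℝ^{p,q}`: the first `p` coordinate vectors have square `1`,
the remaining `q` have square `-1`. -/
def quadForm (p q : ℕ) : QuadraticForm ℝ (Fin (p + q) → ℝ) :=
  QuadraticMap.weightedSumSquares ℝ (fun j : Fin (p + q) => if (j : ℕ) < p then (1 : ℝ) else -1)

/-- The real Clifford algebra `Cl_{p,q}`, in the convention `v * v = Q(v)`. -/
abbrev Cl (p q : ℕ) : Type := CliffordAlgebra (quadForm p q)

/-- The generator `γ_i`, for `1 ≤ i ≤ p + q` (indices start at `1`, as is usual in print;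
for `i` outside this range the vector is zero). -/
def gamma (p q i : ℕ) : Cl p q :=
  CliffordAlgebra.ι (quadForm p q) (fun j : Fin (p + q) => if (j : ℕ) + 1 = i then 1 else 0)

/-- `γ_α = γ_{i₁} ⋯ γ_{iᵣ}` for a multi-index `α = (i₁, …, iᵣ)`. -/
def gammaMono (p q : ℕ) (α : List ℕ) : Cl p q := (α.map (gamma p q)).prod

/-- `α = (i₁ < ⋯ < iᵣ)` with all entries in `{1, …, n}` and `1 ≤ r ≤ 4`, so that `γ_α` is an
`r`-vector of the canonical basis, `1 ≤ r ≤ 4`. -/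
def IsBasisIndex (n : ℕ) (α : List ℕ) : Prop :=
  α.Pairwise (· < ·) ∧ (∀ i ∈ α, 1 ≤ i ∧ i ≤ n) ∧ 1 ≤ α.length ∧ α.length ≤ 4

/-- Radon–Hurwitz numbers `r_i` for `i ≥ 0`. -/
def radonHurwitzNat : ℕ → ℤ
  | 0 => 0
  | 1 => 1
  | 2 => 2
  | 3 => 2
  | 4 => 3
  | 5 => 3
  | 6 => 3
  | 7 => 3
  | i + 8 => radonHurwitzNat i + 4

/-- Radon–Hurwitz numbers for all integers: `r_{-1} = -1`, and `r_{-i} = 1 - i + r_{i-2}` for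
`i ≥ 2` (here `Int.negSucc (j + 1) = -(j + 2)`). -/
def radonHurwitz : ℤ → ℤ
  | Int.ofNat i => radonHurwitzNat i
  | Int.negSucc 0 => -1
  | Int.negSucc (j + 1) => 1 - ((j : ℤ) + 2) + radonHurwitzNat j

/-- The pairs `(i, s + i)`, `1 ≤ i ≤ m`. -/
def pairs (m s : ℕ) : List (List ℕ) := (List.range m).map fun i => [i + 1, s + (i + 1)]

/-- The `4 l` quadruples obtained from `l` consecutive blocks of eight indices, the first block
starting after the index `s` (here `i` runs over `0, …, l - 1`). -/
def quads (s l : ℕ) : List (List ℕ) := (List.range l).flatMap fun i =>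
  [[s + 8 * i + 1, s + 8 * i + 2, s + 8 * i + 3, s + 8 * i + 4],
   [s + 8 * i + 1, s + 8 * i + 2, s + 8 * i + 5, s + 8 * i + 6],
   [s + 8 * i + 1, s + 8 * i + 2, s + 8 * i + 7, s + 8 * i + 8],
   [s + 8 * i + 1, s + 8 * i + 3, s + 8 * i + 5, s + 8 * i + 7]]

/-- `P₂ = {(1, p+1), …, (p, 2p)}`, for signature `(p, p + 8l + a)`. -/
def P2 (p : ℕ) : List (List ℕ) := pairs p p

/-- `P₄`, for signature `(p, p + 8l + a)`. -/
def P4 (p l : ℕ) : List (List ℕ) := quads (2 * p) l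

/-- `Q₂ = {(1, q+8l+a+1), …, (q, 2q+8l+a)}`, for signature `(q + 8l + a, q)`. -/
def Q2 (q l a : ℕ) : List (List ℕ) := pairs q (q + 8 * l + a)

/-- `Q₄`, for signature `(q + 8l + a, q)`. -/
def Q4 (q l : ℕ) : List (List ℕ) := quads q l

/-- The additional multi-indices for signature `(p, p + 8l + a)`, with `m = 2p + 8l`. -/
def extraP (m : ℕ) : ℕ → List (List ℕ)
  | 3 => [[m + 1, m + 2, m + 3]]
  | 4 => [[m + 1, m + 2, m + 3, m + 4]]
  | 5 => [[m + 1, m + 2, m + 3, m + 4], [m + 1, m + 2, m + 5]]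
  | 6 => [[m + 1, m + 2, m + 4], [m + 2, m + 3, m + 5], [m + 3, m + 4, m + 6]]
  | 7 => [[m + 1, m + 2, m + 4], [m + 2, m + 3, m + 5], [m + 3, m + 4, m + 6],
          [m + 4, m + 5, m + 7]]
  | _ => []

/-- The additional multi-indices for signature `(q + 8l + a, q)`, with `m = q + 8l`. -/
def extraQ (m : ℕ) : ℕ → List (List ℕ)
  | 1 => [[m + 1]]
  | 2 => [[m + 1]]
  | 3 => [[m + 1]]
  | 4 => [[m + 1]]
  | 5 => [[m + 1, m + 2, m + 3, m + 4], [m + 5]]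
  | 6 => [[m + 1, m + 2, m + 3, m + 4], [m + 1, m + 2, m + 5, m + 6]]
  | 7 => [[m + 1, m + 2, m + 3, m + 4], [m + 1, m + 2, m + 5, m + 6], [m + 7]]
  | _ => []

/-- The multi-indices listed for signature `(p, p + 8l + a)`, `0 ≤ a ≤ 7`. -/
def tableP (p l a : ℕ) : List (List ℕ) := P2 p ++ P4 p l ++ extraP (2 * p + 8 * l) a

/-- The multi-indices listed for signature `(q + 8l + a, q)`, `0 ≤ a ≤ 7`. -/
def tableQ (q l a : ℕ) : List (List ℕ) := Q2 q l a ++ Q4 q l ++ extraQ (q + 8 * l) a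

/-- The number `k` listed for signature `(p, p + 8l + a)`, `0 ≤ a ≤ 7`. -/
def kP (p l : ℕ) : ℕ → ℕ
  | 3 => p + 4 * l + 1
  | 4 => p + 4 * l + 1
  | 5 => p + 4 * l + 2
  | 6 => p + 4 * l + 3
  | 7 => p + 4 * l + 4
  | _ => p + 4 * l

/-- The number `k` listed for signature `(q + 8l + a, q)`, `0 ≤ a ≤ 7`. -/
def kQ (q l : ℕ) : ℕ → ℕ
  | 1 => q + 4 * l + 1
  | 2 => q + 4 * l + 1
  | 3 => q + 4 * l + 1
  | 4 => q + 4 * l + 1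
  | 5 => q + 4 * l + 2
  | 6 => q + 4 * l + 2
  | 7 => q + 4 * l + 3
  | _ => q + 4 * l

/-- The set `{γ_α : α ∈ L}` in `Cl_{p,q}`. -/
def gammaSet (p q : ℕ) (L : List (List ℕ)) : Set (Cl p q) := {g | ∃ α ∈ L, gammaMono p q α = g}

/-- The product `F = ∏_{α ∈ L} (1 + γ_α) / 2`, in the order of the list `L`. -/
def idem (p q : ℕ) (L : List (List ℕ)) : Cl p q :=
  (L.map fun α => (1 / 2 : ℝ) • (1 + gammaMono p q α)).prod

/-- A generating set for `Cl_{p,q}`: a set of `k = q - r_{q-p}` mutually commuting involutions,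
none of which is a product of others. -/
structure IsGeneratingSet (p q : ℕ) (G : Set (Cl p q)) : Prop where
  finite : G.Finite
  card : (G.ncard : ℤ) = (q : ℤ) - radonHurwitz ((q : ℤ) - (p : ℤ))
  involution : ∀ g ∈ G, g * g = 1
  commute : ∀ g ∈ G, ∀ h ∈ G, g * h = h * g
  independent : ∀ g ∈ G, g ∉ Submonoid.closure (G \ {g})

/-- A primitive idempotent: a nonzero idempotent that is not the sum of two nonzero idempotents
annihilating each other. -/
def IsPrimitiveIdempotent {A : Type*} [Ring A] (F : A) : Prop :=
  F ≠ 0 ∧ F * F = F ∧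
    ∀ e f : A, e * e = e → f * f = f → e * f = 0 → f * e = 0 → e + f = F → e = 0 ∨ f = 0

/-- The left ideal `A F = {x F : x ∈ A}`. -/
def leftIdeal {A : Type*} [Ring A] (F : A) : Ideal A := Ideal.span {F}

end CliffordTables

end

/-!
A monomial `γ_α` is determined up to sign by the parity vector over `𝔽₂` of the word `α`, and two
monomials commute or anticommute. For commuting involutions `γ_α`, `α ∈ L`, the element `F` is the
average over the group they generate. Since right multiplication by a monomial has trace zero
unless its parity vector vanishes, independence of the parity vectors gives
`dim Cl_{p,q} F = tr F = 2 ^ (n - k)`.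

For minimality, let `x ↦ x̄` be the anti-automorphism inverting every monomial; `tr (x̄ x)` is
positive definite and `F̄ = F`. For a monomial `y` with `y² = -1` one has `y + ȳ = 0`; if `y² = 1`
and `y` anticommutes with some `γ_α`, then `F y F = 0`; and if `y² = 1` and `y` commutes with all
`γ_α`, then maximality of the family puts `± y` in the group, so `F y F = ± F`. Hence
`F (y + ȳ) F ∈ ℝ F` for all `y`, and every `x = x F ≠ 0` satisfies `x̄ x = c F` with `c ≠ 0`, so
that `F` lies in the left ideal of `x`.

Maximality is a statement about binary codes: the pairs `(i, s + i)` and the octets, which are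
extended Hamming codes, are self-dual codes of even words, so they can be split off, and what is
left concerns at most seven generators with equal squares.
-/

noncomputable section

namespace CliffordTables

section Ideals

variable {A : Type*} [Ring A] {F : A}

lemma mem_leftIdeal_iff (hF : IsIdempotentElem F) {x : A} : x ∈ leftIdeal F ↔ x * F = x := by
  rw [leftIdeal, Ideal.mem_span_singleton']
  refine ⟨?_, fun hx => ⟨x, hx⟩⟩
  rintro ⟨y, rfl⟩
  rw [mul_assoc, hF.eq]

lemma isAtom_leftIdeal (hF : IsIdempotentElem F) (hF₀ : F ≠ 0)
    (hinv : ∀ x, x ≠ 0 → x * F = x → ∃ z, z * x = F) : IsAtom (leftIdeal F) := by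
  refine ⟨fun hbot => hF₀ ?_, fun I hI => ?_⟩
  · rwa [leftIdeal, Ideal.span_singleton_eq_bot] at hbot
  · by_contra hI₀
    obtain ⟨x, hxI, hx₀⟩ := Submodule.exists_mem_ne_zero_of_ne_bot hI₀
    obtain ⟨z, hz⟩ := hinv x hx₀ ((mem_leftIdeal_iff hF).1 (hI.le hxI))
    have hFI : F ∈ I := hz ▸ I.mul_mem_left z hxI
    exact hI.not_ge ((Ideal.span_singleton_le_iff_mem I).2 hFI)

lemma isPrimitiveIdempotent_of_isAtom_leftIdeal (hF : IsIdempotentElem F)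
    (hatom : IsAtom (leftIdeal F)) : IsPrimitiveIdempotent F := by
  refine ⟨?_, hF, fun e f he hf hef _ hsum => or_iff_not_imp_left.2 fun he₀ => ?_⟩
  · rintro rfl
    exact hatom.1 (Ideal.span_singleton_eq_bot.2 rfl)
  · have heF : e ∈ leftIdeal F :=
      (mem_leftIdeal_iff hF).2 (by rw [← hsum, mul_add, he, hef, add_zero])
    have hspan : Ideal.span {e} = leftIdeal F :=
      (hatom.le_iff.1 ((Ideal.span_singleton_le_iff_mem _).2 heF)).resolve_left
        (mt Ideal.span_singleton_eq_bot.1 he₀)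
    obtain ⟨z, hz⟩ : ∃ z, z * e = F :=
      Ideal.mem_span_singleton'.1 (hspan ▸ Ideal.mem_span_singleton_self F)
    calc f = F * f := by rw [← hsum, add_mul, hef, hf, zero_add]
      _ = 0 := by rw [← hz, mul_assoc, hef, mul_zero]

end Ideals

section Corner

variable {K A : Type*} [Field K] [NeZero (2 : K)] [Ring A] [Algebra K A]

/- With `y = conj x * x`, which is fixed by `conj`, the corner condition reads `2 y = c F`. -/
lemma exists_mul_eq_of_corner_subset_span (conj : A →ₗ[K] A)
    (conj_mul : ∀ x y, conj (x * y) = conj y * conj x) (conj_conj : ∀ x, conj (conj x) = x)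
    (definite : ∀ x, conj x * x = 0 → x = 0) {F : A} (hF : conj F = F)
    (hcorner : ∀ y, ∃ c : K, F * (y + conj y) * F = c • F) {x : A} (hx₀ : x ≠ 0)
    (hx : x * F = x) : ∃ z, z * x = F := by
  obtain ⟨c, hc⟩ := hcorner (conj x * x)
  have hFx : F * conj x = conj x := by rw [← hF, ← conj_mul, hx]
  have hsq : (2 : K) • (conj x * x) = c • F := by
    rw [← hc, conj_mul, conj_conj, mul_add, add_mul, ← mul_assoc, hFx, mul_assoc, hx, two_smul]
  have hc₀ : c ≠ 0 := by
    rintro rfl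
    rw [zero_smul] at hsq
    exact hx₀ (definite x ((smul_eq_zero.1 hsq).resolve_left two_ne_zero))
  exact ⟨(c⁻¹ * 2) • conj x, by rw [smul_mul_assoc, mul_smul, hsq, inv_smul_smul₀ hc₀]⟩

end Corner

section Trace

variable (K : Type*) {A : Type*} [Field K] [Ring A] [Algebra K A]

/-- The trace of right multiplication by an element of a `K`-algebra `A`. It measures the dimension
of the left ideal generated by an idempotent, and is `0` if `A` is infinite-dimensional. -/
def rightTrace : A →ₗ[K] K := LinearMap.trace K A ∘ₗ (LinearMap.mul K A).flip

lemma rightTrace_apply (x : A) :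
    rightTrace K x = LinearMap.trace K A (LinearMap.mulRight K x) := rfl

lemma rightTrace_one [Module.Finite K A] : rightTrace K (1 : A) = Module.finrank K A := by
  rw [rightTrace_apply, LinearMap.mulRight_one, LinearMap.trace_id]

lemma rightTrace_mul_comm (x y : A) : rightTrace K (x * y) = rightTrace K (y * x) := by
  simp only [rightTrace_apply, LinearMap.mulRight_mul]
  exact LinearMap.trace_mul_comm K _ _

lemma rightTrace_algEquiv (φ : A ≃ₐ[K] A) (x : A) : rightTrace K (φ x) = rightTrace K x := by
  have hconj : LinearMap.mulRight K (φ x) = φ.toLinearEquiv.conj (LinearMap.mulRight K x) := by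
    ext; simp [LinearEquiv.conj_apply]
  rw [rightTrace_apply, hconj, LinearMap.trace_conj', rightTrace_apply]

lemma eq_zero_of_eq_neg [NeZero (2 : K)] {x : A} (hx : x = -x) : x = 0 :=
  (smul_eq_zero.1 (by rw [two_smul]; exact eq_neg_iff_add_eq_zero.1 hx)).resolve_left
    (two_ne_zero (α := K))

lemma rightTrace_eq_zero_of_anticommute [NeZero (2 : K)] {u x : A} (hu : IsUnit u)
    (hux : u * x = -(x * u)) : rightTrace K x = 0 := by
  obtain ⟨u, rfl⟩ := hu
  have hx : x = -(u * (x * ↑u⁻¹)) := by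
    rw [← mul_assoc, hux, neg_mul, neg_neg, Units.mul_inv_cancel_right]
  have hneg : rightTrace K x = -rightTrace K x := by
    conv_lhs => rw [hx, map_neg, rightTrace_mul_comm, Units.inv_mul_cancel_right]
  exact eq_zero_of_eq_neg K hneg

lemma finrank_leftIdeal [Module.Finite K A] {F : A} (hF : IsIdempotentElem F) :
    (Module.finrank K (leftIdeal F) : K) = rightTrace K F := by
  have hproj : LinearMap.IsProj ((leftIdeal F).restrictScalars K) (LinearMap.mulRight K F) :=
    ⟨fun x => (mem_leftIdeal_iff hF).2 (by simp [mul_assoc, hF.eq]),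
      fun x hx => (mem_leftIdeal_iff hF).1 hx⟩
  exact hproj.trace.symm

end Trace

section HalfSums

variable (K : Type*) {A : Type*} [Field K] [Ring A] [Algebra K A] {gs hs : List A}

/-- The product `∏ (1 + g) / 2` over a list, taken in the order of the list. -/
def halfSumProd (gs : List A) : A := (gs.map fun g => (1 / 2 : K) • (1 + g)).prod

/-- The elements of a list square to `1` and commute with each other. -/
structure IsCommutingInvolutions (gs : List A) : Prop where
  mul_self : ∀ g ∈ gs, g * g = 1
  commute : ∀ g ∈ gs, ∀ h ∈ gs, Commute g h

lemma IsCommutingInvolutions.of_subset (hgs : IsCommutingInvolutions gs) (hsub : hs ⊆ gs) :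
    IsCommutingInvolutions hs :=
  ⟨fun g hg => hgs.mul_self g (hsub hg), fun g hg h hh => hgs.commute g (hsub hg) h (hsub hh)⟩

lemma halfSumProd_cons (g : A) (gs : List A) :
    halfSumProd K (g :: gs) = (1 / 2 : K) • ((1 + g) * halfSumProd K gs) := by
  simp only [halfSumProd, List.map_cons, List.prod_cons, smul_mul_assoc]

lemma commute_halfSumProd {x : A} (hx : ∀ g ∈ gs, Commute x g) :
    Commute x (halfSumProd K gs) := by
  refine Commute.list_prod_right _ _ fun y hy => ?_
  obtain ⟨g, hg, rfl⟩ := List.mem_map.1 hy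
  exact ((Commute.one_right x).add_right (hx g hg)).smul_right _

lemma halfSumProd_mul_of_forall_mul_eq [NeZero (2 : K)] {y : A} (hy : ∀ g ∈ gs, g * y = y) :
    halfSumProd K gs * y = y := by
  induction gs with
  | nil => simp [halfSumProd]
  | cons g gs ih =>
    rw [halfSumProd_cons, smul_mul_assoc, mul_assoc,
      ih fun h hh => hy h (List.mem_cons_of_mem _ hh), add_mul, one_mul,
      hy g List.mem_cons_self, ← two_smul K, smul_smul, one_div_mul_cancel two_ne_zero, one_smul]

lemma mul_halfSumProd_of_mem (hgs : IsCommutingInvolutions gs) {g : A} (hg : g ∈ gs) :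
    g * halfSumProd K gs = halfSumProd K gs := by
  induction gs with
  | nil => simp at hg
  | cons h gs ih =>
    rw [halfSumProd_cons, mul_smul_comm, ← mul_assoc]
    rcases List.mem_cons.1 hg with rfl | hg'
    · rw [mul_add, hgs.mul_self g hg, mul_one, add_comm]
    · have hcomm : Commute g (1 + h) :=
        (Commute.one_right g).add_right (hgs.commute g hg h List.mem_cons_self)
      rw [hcomm.eq, mul_assoc, ih (hgs.of_subset (List.subset_cons_self h gs)) hg']

lemma halfSumProd_mul_of_mem (hgs : IsCommutingInvolutions gs) {g : A} (hg : g ∈ gs) :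
    halfSumProd K gs * g = halfSumProd K gs := by
  rw [← (commute_halfSumProd K (hgs.commute g hg)).eq, mul_halfSumProd_of_mem K hgs hg]

lemma mul_halfSumProd_of_mem_closure (hgs : IsCommutingInvolutions gs) {x : A}
    (hx : x ∈ Submonoid.closure {g | g ∈ gs}) : x * halfSumProd K gs = halfSumProd K gs := by
  induction hx using Submonoid.closure_induction with
  | mem g hg => exact mul_halfSumProd_of_mem K hgs hg
  | one => exact one_mul _
  | mul x y _ _ hx hy => rw [mul_assoc, hy, hx]

lemma map_halfSumProd_of_antimultiplicative (hgs : IsCommutingInvolutions gs) (φ : A →ₗ[K] A)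
    (map_one : φ 1 = 1) (map_mul : ∀ x y, φ (x * y) = φ y * φ x) (hφ : ∀ g ∈ gs, φ g = g) :
    φ (halfSumProd K gs) = halfSumProd K gs := by
  induction gs with
  | nil => simpa [halfSumProd] using map_one
  | cons g gs ih =>
    have hcomm : Commute (1 + g) (halfSumProd K gs) :=
      (Commute.one_left _).add_left <| commute_halfSumProd K fun h hh =>
        hgs.commute g List.mem_cons_self h (List.mem_cons_of_mem _ hh)
    rw [halfSumProd_cons, map_smul, map_mul, map_add, map_one, hφ g List.mem_cons_self,
      ih (hgs.of_subset (List.subset_cons_self g gs))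
        fun h hh => hφ h (List.mem_cons_of_mem _ hh), hcomm.eq]

variable [NeZero (2 : K)]

lemma isIdempotentElem_halfSumProd (hgs : IsCommutingInvolutions gs) :
    IsIdempotentElem (halfSumProd K gs) :=
  halfSumProd_mul_of_forall_mul_eq K fun _ hg => mul_halfSumProd_of_mem K hgs hg

lemma halfSumProd_eq_of_subset (hgs : IsCommutingInvolutions gs) (hsub : hs ⊆ gs)
    (hcl : ∀ g ∈ gs, g ∈ Submonoid.closure {h | h ∈ hs}) :
    halfSumProd K gs = halfSumProd K hs := by
  have hhs := hgs.of_subset hsub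
  have hcomm : Commute (halfSumProd K hs) (halfSumProd K gs) :=
    commute_halfSumProd K fun g hg =>
      (commute_halfSumProd K fun h hh => hgs.commute g hg h (hsub hh)).symm
  calc halfSumProd K gs = halfSumProd K hs * halfSumProd K gs :=
        (halfSumProd_mul_of_forall_mul_eq K fun h hh =>
          mul_halfSumProd_of_mem K hgs (hsub hh)).symm
    _ = halfSumProd K gs * halfSumProd K hs := hcomm.eq
    _ = halfSumProd K hs := halfSumProd_mul_of_forall_mul_eq K fun g hg =>
          mul_halfSumProd_of_mem_closure K hhs (hcl g hg)

lemma halfSumProd_mul_mul_halfSumProd_of_anticommute (hgs : IsCommutingInvolutions gs) {g x : A}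
    (hg : g ∈ gs) (hgx : g * x = -(x * g)) : halfSumProd K gs * x * halfSumProd K gs = 0 := by
  set P := halfSumProd K gs
  refine eq_zero_of_eq_neg K ?_
  calc P * x * P = P * g * x * P := by rw [halfSumProd_mul_of_mem K hgs hg]
    _ = -(P * x * (g * P)) := by rw [mul_assoc P g, hgx]; simp only [mul_neg, neg_mul, mul_assoc]
    _ = -(P * x * P) := by rw [mul_halfSumProd_of_mem K hgs hg]

end HalfSums

section Parity

variable {α β : List ℕ} {i : ℕ}

/-- The vector over `𝔽₂` counting the occurrences of each letter in a word. Up to sign, it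
determines the monomial spelled by the word. -/
def parity (α : List ℕ) (i : ℕ) : ZMod 2 := (α.count i : ZMod 2)

lemma parity_nil : parity [] = 0 := by ext; simp [parity]

lemma parity_append (α β : List ℕ) : parity (α ++ β) = parity α + parity β := by
  ext; simp [parity]

lemma parity_append_self (α : List ℕ) : parity (α ++ α) = 0 := by
  rw [parity_append, CharTwo.add_self_eq_zero]

lemma parity_eq_of_perm (h : α.Perm β) : parity α = parity β := by
  ext i; rw [parity, h.count_eq, parity]

lemma mem_of_parity_ne_zero (h : parity α i ≠ 0) : i ∈ α := by
  by_contra hi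
  exact h (by rw [parity, List.count_eq_zero_of_not_mem hi, Nat.cast_zero])

lemma parity_of_nodup (hα : α.Nodup) (i : ℕ) : parity α i = if i ∈ α then 1 else 0 := by
  split_ifs with hi
  · rw [parity, List.count_eq_one_of_mem hα hi, Nat.cast_one]
  · rw [parity, List.count_eq_zero_of_not_mem hi, Nat.cast_zero]

lemma eq_of_parity_eq (hα : α.Pairwise (· < ·)) (hβ : β.Pairwise (· < ·))
    (h : parity α = parity β) : α = β := by
  refine List.Perm.eq_of_pairwise' hα hβ
    ((List.perm_ext_iff_of_nodup hα.nodup hβ.nodup).2 fun i => ?_)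
  have hi := congrFun h i
  rw [parity_of_nodup hα.nodup, parity_of_nodup hβ.nodup] at hi
  by_cases h₁ : i ∈ α <;> by_cases h₂ : i ∈ β <;> simp_all

lemma exists_sublist_parity_eq {l : List ℕ} (hl : l.Nodup) {v : ℕ → ZMod 2}
    (hv : ∀ i, v i ≠ 0 → i ∈ l) : ∃ w, w.Sublist l ∧ parity w = v := by
  refine ⟨l.filter fun i => v i ≠ 0, List.filter_sublist, funext fun i => ?_⟩
  have hone : ∀ x : ZMod 2, x ≠ 0 → x = 1 := by decide
  rw [parity_of_nodup (hl.filter _)]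
  by_cases hi : v i = 0
  · simp [hi]
  · simp [hv i hi, hone _ hi]

end Parity

section Words

variable {p q : ℕ} {α β : List ℕ} {i j : ℕ}

/-- The indices `1, …, n` of the generators. Words in the generators are lists of letters. -/
abbrev letters (n : ℕ) : List ℕ := List.range' 1 n

lemma gammaMono_nil : gammaMono p q [] = 1 := rfl

lemma gammaMono_cons (i : ℕ) (α : List ℕ) :
    gammaMono p q (i :: α) = gamma p q i * gammaMono p q α := by
  rw [gammaMono, List.map_cons, List.prod_cons, gammaMono]

lemma gammaMono_append (α β : List ℕ) :
    gammaMono p q (α ++ β) = gammaMono p q α * gammaMono p q β := by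
  rw [gammaMono, List.map_append, List.prod_append, gammaMono, gammaMono]

/-- The square of the generator `γ_i`. -/
def genSign (p i : ℕ) : ℤˣ := if i ≤ p then 1 else -1

lemma gamma_mul_self (hi : i ∈ letters (p + q)) :
    gamma p q i * gamma p q i = genSign p i • (1 : Cl p q) := by
  obtain ⟨h₁, h₂⟩ := List.mem_range'_1.1 hi
  have hsq : quadForm p q (fun j => if (j : ℕ) + 1 = i then 1 else 0) = (genSign p i : ℤ) := by
    simp only [quadForm, QuadraticMap.weightedSumSquares_apply]
    rw [Finset.sum_eq_single ⟨i - 1, by omega⟩]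
    · rcases le_or_gt i p with hip | hip
      · simp [genSign, hip, show i - 1 + 1 = i by omega, show i - 1 < p by omega]
      · simp [genSign, hip.not_ge, show i - 1 + 1 = i by omega, show ¬ i - 1 < p by omega]
    · intro j _ hj
      have hji : ¬ (j : ℕ) + 1 = i := fun h => hj (Fin.ext (by simp only; omega))
      simp [hji]
    · simp
  rw [gamma, CliffordAlgebra.ι_sq_scalar, hsq, map_intCast, Units.smul_def, zsmul_one]

lemma gamma_mul_gamma_of_ne (hij : i ≠ j) :
    gamma p q i * gamma p q j = -(gamma p q j * gamma p q i) := by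
  refine CliffordAlgebra.ι_mul_ι_comm_of_isOrtho ?_
  rw [QuadraticMap.isOrtho_def]
  simp only [quadForm, QuadraticMap.weightedSumSquares_apply, ← Finset.sum_add_distrib]
  refine Finset.sum_congr rfl fun k _ => ?_
  by_cases hk : (k : ℕ) + 1 = i
  · simp [hk, hij]
  · simp [hk]

lemma gamma_mul_gammaMono (i : ℕ) (β : List ℕ) :
    gamma p q i * gammaMono p q β =
      (-1 : ℤˣ) ^ (β.length + β.count i) • (gammaMono p q β * gamma p q i) := by
  induction β with
  | nil => simp [gammaMono_nil]
  | cons j β ih =>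
    rcases eq_or_ne i j with rfl | hij
    · have hexp : (i :: β).length + (i :: β).count i = β.length + β.count i + 2 := by
        rw [List.length_cons, List.count_cons_self]; ring
      rw [hexp, pow_add, neg_one_sq, mul_one, gammaMono_cons, mul_assoc, ← mul_smul_comm, ← ih]
    · rw [List.count_cons_of_ne hij.symm, List.length_cons, add_right_comm, pow_succ,
        mul_neg_one, Units.neg_smul, gammaMono_cons, ← mul_assoc, gamma_mul_gamma_of_ne hij,
        neg_mul, mul_assoc, ih, mul_smul_comm, mul_assoc]

/-- The number of pairs of equal letters, one in `α` and one in `β`. -/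
def coincidences (α β : List ℕ) : ℕ := (α.map fun i => β.count i).sum

/-- The exponent of the sign `(-1)^c` in `γ_α γ_β = (-1)^c γ_β γ_α`; modulo `2` it counts the
pairs of distinct letters, one in `α` and one in `β`. -/
def crossings (α β : List ℕ) : ℕ := α.length * β.length + coincidences α β

lemma gammaMono_mul_gammaMono (α β : List ℕ) :
    gammaMono p q α * gammaMono p q β =
      (-1 : ℤˣ) ^ crossings α β • (gammaMono p q β * gammaMono p q α) := by
  induction α with
  | nil => simp [crossings, coincidences, gammaMono_nil]
  | cons i α ih =>
    have hexp : crossings (i :: α) β = crossings α β + (β.length + β.count i) := by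
      simp only [crossings, coincidences, List.length_cons, List.map_cons, List.sum_cons]
      ring
    rw [gammaMono_cons, mul_assoc, ih, mul_smul_comm, ← mul_assoc, gamma_mul_gammaMono,
      smul_mul_assoc, smul_smul, mul_assoc, hexp, pow_add _ (crossings α β)]

lemma commute_gammaMono_of_even (h : Even (crossings α β)) :
    Commute (gammaMono p q α) (gammaMono p q β) := by
  rw [Commute, SemiconjBy, gammaMono_mul_gammaMono, h.neg_one_pow, one_smul]

lemma anticommute_gammaMono_of_odd (h : Odd (crossings α β)) :
    gammaMono p q α * gammaMono p q β = -(gammaMono p q β * gammaMono p q α) := by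
  rw [gammaMono_mul_gammaMono, h.neg_one_pow, Units.neg_smul, one_smul]

lemma exists_gammaMono_eq_smul_of_perm (h : α.Perm β) :
    ∃ u : ℤˣ, gammaMono p q α = u • gammaMono p q β := by
  induction h with
  | nil => exact ⟨1, (one_smul _ _).symm⟩
  | cons i _ ih =>
    obtain ⟨u, hu⟩ := ih
    exact ⟨u, by rw [gammaMono_cons, hu, mul_smul_comm, gammaMono_cons]⟩
  | swap i j l =>
    refine ⟨(-1) ^ crossings [j] [i], ?_⟩
    rw [← List.singleton_append, ← List.singleton_append (l := l), ← List.append_assoc,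
      gammaMono_append, gammaMono_append, gammaMono_mul_gammaMono, smul_mul_assoc,
      ← gammaMono_append, ← gammaMono_append]
    rfl
  | trans _ _ ih₁ ih₂ =>
    obtain ⟨u, hu⟩ := ih₁
    obtain ⟨v, hv⟩ := ih₂
    exact ⟨u * v, by rw [hu, hv, smul_smul]⟩

lemma exists_gammaMono_eq_smul_one (hα : α ⊆ letters (p + q)) (hpar : parity α = 0) :
    ∃ u : ℤˣ, gammaMono p q α = u • (1 : Cl p q) := by
  induction hlen : α.length using Nat.strong_induction_on generalizing α with
  | _ N ih =>
    rcases α with _ | ⟨i, α⟩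
    · exact ⟨1, (one_smul _ _).symm⟩
    have hi : i ∈ α := by
      refine mem_of_parity_ne_zero fun h => ?_
      have hcount := congrFun hpar i
      simp only [parity, List.count_cons_self, Nat.cast_succ, Pi.zero_apply] at hcount
      rw [← parity, h, zero_add] at hcount
      exact one_ne_zero hcount
    have hperm : (i :: α).Perm ([i] ++ [i] ++ α.erase i) := (List.perm_cons_erase hi).cons i
    rw [parity_eq_of_perm hperm, parity_append, parity_append_self, zero_add] at hpar
    rw [List.cons_subset] at hα
    rw [List.length_cons] at hlen
    obtain ⟨u, hu⟩ := exists_gammaMono_eq_smul_of_perm (p := p) (q := q) hperm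
    obtain ⟨v, hv⟩ := ih _ (by have := List.length_erase_of_mem hi; omega)
      (List.Subset.trans List.erase_subset hα.2) hpar rfl
    refine ⟨u * (genSign p i * v), ?_⟩
    rw [hu, gammaMono_append, gammaMono_append, gammaMono_cons, gammaMono_nil, mul_one,
      gamma_mul_self hα.1, hv, smul_one_mul, smul_smul, smul_smul, mul_assoc]

lemma exists_gammaMono_mul_self_eq (hα : α ⊆ letters (p + q)) :
    ∃ u : ℤˣ, gammaMono p q α * gammaMono p q α = u • (1 : Cl p q) := by
  rw [← gammaMono_append]
  exact exists_gammaMono_eq_smul_one (List.append_subset.2 ⟨hα, hα⟩) (parity_append_self α)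

lemma exists_gammaMono_eq_smul_gammaMono (hα : α ⊆ letters (p + q)) (hβ : β ⊆ letters (p + q))
    (hpar : parity α = parity β) : ∃ u : ℤˣ, gammaMono p q α = u • gammaMono p q β := by
  obtain ⟨u, hu⟩ := exists_gammaMono_eq_smul_one (List.append_subset.2 ⟨hα, hβ⟩)
    (by rw [parity_append, hpar, CharTwo.add_self_eq_zero])
  obtain ⟨v, hv⟩ := exists_gammaMono_mul_self_eq hβ
  refine ⟨v * u, ?_⟩
  calc gammaMono p q α = (v * v) • (gammaMono p q α * 1) := by
        rw [Int.units_mul_self, one_smul, mul_one]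
    _ = v • (gammaMono p q α * gammaMono p q β * gammaMono p q β) := by
        rw [mul_assoc, hv, mul_smul, mul_smul_comm]
    _ = (v * u) • gammaMono p q β := by
        rw [← gammaMono_append, hu, smul_one_mul, smul_smul]

lemma isUnit_gammaMono (hα : α ⊆ letters (p + q)) : IsUnit (gammaMono p q α) := by
  obtain ⟨u, hu⟩ := exists_gammaMono_mul_self_eq hα
  refine ⟨⟨gammaMono p q α, u • gammaMono p q α, ?_, ?_⟩, rfl⟩ <;>
    simp only [mul_smul_comm, smul_mul_assoc, hu, smul_smul, Int.units_mul_self, one_smul]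

lemma commute_gammaMono_iff (hα : α ⊆ letters (p + q)) (hβ : β ⊆ letters (p + q)) :
    Commute (gammaMono p q α) (gammaMono p q β) ↔ Even (crossings α β) := by
  refine ⟨fun h => Nat.not_odd_iff_even.1 fun hodd => ?_, commute_gammaMono_of_even⟩
  have hzero : gammaMono p q β * gammaMono p q α = 0 :=
    eq_zero_of_eq_neg ℝ (h.eq.symm.trans (anticommute_gammaMono_of_odd hodd))
  exact ((isUnit_gammaMono hβ).mul (isUnit_gammaMono hα)).ne_zero hzero

lemma gammaMono_mul_self_of_nodup (hα : α ⊆ letters (p + q)) (hnodup : α.Nodup) :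
    gammaMono p q α * gammaMono p q α =
      ((-1 : ℤˣ) ^ α.length.choose 2 * (α.map (genSign p)).prod) • (1 : Cl p q) := by
  induction α with
  | nil => simp [gammaMono_nil]
  | cons i α ih =>
    rw [List.cons_subset] at hα
    rw [List.nodup_cons] at hnodup
    have hswap : gammaMono p q α * gamma p q i =
        (-1 : ℤˣ) ^ α.length • (gamma p q i * gammaMono p q α) := by
      rw [gamma_mul_gammaMono, List.count_eq_zero_of_not_mem hnodup.1, add_zero, smul_smul,
        Int.units_mul_self, one_smul]
    have hchoose : (α.length + 1).choose 2 = α.length + α.length.choose 2 := by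
      rw [Nat.choose_succ_succ' α.length 1, Nat.choose_one_right]
    calc gammaMono p q (i :: α) * gammaMono p q (i :: α)
        = (-1 : ℤˣ) ^ α.length • (gamma p q i * gamma p q i *
            (gammaMono p q α * gammaMono p q α)) := by
          rw [gammaMono_cons, mul_assoc, ← mul_assoc (gammaMono p q α), hswap, smul_mul_assoc,
            mul_smul_comm]
          simp only [mul_assoc]
      _ = _ := by
          rw [gamma_mul_self hα.1, ih hα.2 hnodup.2, smul_one_mul, smul_smul, smul_smul,
            List.length_cons, hchoose, List.map_cons, List.prod_cons, pow_add,
            mul_mul_mul_comm]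

end Words

section Conjugation

variable {p q : ℕ} {α : List ℕ}

/-- The isometry of `ℝ^{p,q}` multiplying each coordinate vector by its square. -/
def signIsometry (p q : ℕ) : quadForm p q →qᵢ quadForm p q where
  toFun v j := genSign p (j + 1) • v j
  map_add' _ _ := funext fun _ => smul_add _ _ _
  map_smul' c v := funext fun j => smul_comm (genSign p (j + 1)) c (v j)
  map_app' v := by
    simp only [quadForm, QuadraticMap.weightedSumSquares_apply]
    refine Finset.sum_congr rfl fun j _ => ?_
    rcases Int.units_eq_one_or (genSign p (j + 1)) with h | h <;> simp [h]

/-- The anti-automorphism of `Cl_{p,q}` inverting each generator, hence each monomial. It plays the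
role of the adjoint: `⟨x, y⟩ = rightTrace ℝ (conj x * y)` is positive definite. -/
def conj : Cl p q →ₗ[ℝ] Cl p q :=
  CliffordAlgebra.reverse ∘ₗ (CliffordAlgebra.map (signIsometry p q)).toLinearMap

lemma conj_mul (x y : Cl p q) : conj (x * y) = conj y * conj x := by
  simp [conj, CliffordAlgebra.reverse.map_mul]

lemma conj_one : conj (1 : Cl p q) = 1 := by
  simp [conj]

lemma conj_ι (v : Fin (p + q) → ℝ) :
    conj (CliffordAlgebra.ι (quadForm p q) v) =
      CliffordAlgebra.ι (quadForm p q) fun j => genSign p (j + 1) • v j := by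
  simp only [conj, LinearMap.comp_apply, AlgHom.toLinearMap_apply, CliffordAlgebra.map_apply_ι,
    CliffordAlgebra.reverse_ι]
  rfl

lemma conj_conj (x : Cl p q) : conj (conj x) = x := by
  induction x using CliffordAlgebra.induction with
  | algebraMap r => rw [Algebra.algebraMap_eq_smul_one, map_smul, conj_one, map_smul, conj_one]
  | ι v => simp only [conj_ι, smul_smul, Int.units_mul_self, one_smul]
  | mul a b ha hb => rw [conj_mul, conj_mul, ha, hb]
  | add a b ha hb => rw [map_add, map_add, ha, hb]

lemma conj_gamma (i : ℕ) : conj (gamma p q i) = genSign p i • gamma p q i := by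
  rw [gamma, conj_ι, ← map_zsmul_unit]
  congr 1
  ext j
  by_cases hj : (j : ℕ) + 1 = i <;> simp [hj]

lemma conj_gammaMono_mul_self (hα : α ⊆ letters (p + q)) :
    conj (gammaMono p q α) * gammaMono p q α = 1 := by
  induction α with
  | nil => rw [gammaMono_nil, conj_one, mul_one]
  | cons i α ih =>
    rw [List.cons_subset] at hα
    rw [gammaMono_cons, conj_mul, conj_gamma, mul_assoc, ← mul_assoc (_ • _), smul_mul_assoc,
      gamma_mul_self hα.1, smul_smul, Int.units_mul_self, one_smul, one_mul, ih hα.2]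

lemma conj_gammaMono {u : ℤˣ} (hα : α ⊆ letters (p + q))
    (hu : gammaMono p q α * gammaMono p q α = u • (1 : Cl p q)) :
    conj (gammaMono p q α) = u • gammaMono p q α := by
  calc conj (gammaMono p q α)
      = u • (conj (gammaMono p q α) * (gammaMono p q α * gammaMono p q α)) := by
        rw [hu, mul_smul_comm, mul_one, smul_smul, Int.units_mul_self, one_smul]
    _ = u • gammaMono p q α := by rw [← mul_assoc, conj_gammaMono_mul_self hα, one_mul]

end Conjugation

section Basis

variable {p q : ℕ} {α : List ℕ}

lemma span_gammaMono :
    Submodule.span ℝ {x : Cl p q | ∃ α ⊆ letters (p + q), gammaMono p q α = x} = ⊤ := by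
  set G : Set (Cl p q) := gamma p q '' {i | i ∈ letters (p + q)}
  have hadjoin : Algebra.adjoin ℝ G = ⊤ := by
    rw [eq_top_iff, ← CliffordAlgebra.adjoin_range_ι, Algebra.adjoin_le_iff]
    rintro _ ⟨v, rfl⟩
    have hv : v = ∑ j, v j •
        (fun k : Fin (p + q) => if (k : ℕ) + 1 = (j : ℕ) + 1 then (1 : ℝ) else 0) := by
      ext k
      simp [Finset.sum_apply, Fin.val_inj]
    rw [hv, map_sum]
    refine Subalgebra.sum_mem _ fun j _ => ?_
    have hj : gamma p q (j + 1) ∈ G := ⟨j + 1, List.mem_range'_1.2 (by omega), rfl⟩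
    rw [map_smul]
    exact Subalgebra.smul_mem _ (Algebra.subset_adjoin hj) (v j)
  rw [eq_top_iff, ← Algebra.top_toSubmodule, ← hadjoin, Algebra.adjoin_eq_span]
  refine Submodule.span_mono fun x hx => ?_
  induction hx using Submonoid.closure_induction with
  | mem x hx =>
    obtain ⟨i, hi, rfl⟩ := hx
    exact ⟨[i], by simpa using hi, by rw [gammaMono_cons, gammaMono_nil, mul_one]⟩
  | one => exact ⟨[], List.nil_subset _, gammaMono_nil⟩
  | mul x y _ _ hx hy =>
    obtain ⟨α, hα, rfl⟩ := hx
    obtain ⟨β, hβ, rfl⟩ := hy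
    exact ⟨α ++ β, List.append_subset.2 ⟨hα, hβ⟩, gammaMono_append α β⟩

/-- The words spelling the canonical basis of `Cl_{p,q}`. -/
def basisWords (n : ℕ) : Finset (List ℕ) := (letters n).sublists.toFinset

/-- The canonical basis of `Cl_{p,q}`. -/
def basisMono (p q : ℕ) (α : basisWords (p + q)) : Cl p q := gammaMono p q α

lemma mem_basisWords {n : ℕ} : α ∈ basisWords n ↔ α.Sublist (letters n) := by
  rw [basisWords, List.mem_toFinset, List.mem_sublists]

lemma card_basisWords (n : ℕ) : (basisWords n).card = 2 ^ n := by
  rw [basisWords, List.toFinset_card_of_nodup (List.nodup_sublists.2 List.nodup_range'),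
    List.length_sublists, List.length_range']

lemma span_range_basisMono : Submodule.span ℝ (Set.range (basisMono p q)) = ⊤ := by
  rw [eq_top_iff, ← span_gammaMono, Submodule.span_le]
  rintro _ ⟨α, hα, rfl⟩
  obtain ⟨w, hw, hpar⟩ := exists_sublist_parity_eq (l := letters (p + q)) List.nodup_range'
    fun i hi => hα (mem_of_parity_ne_zero hi)
  obtain ⟨u, hu⟩ := exists_gammaMono_eq_smul_gammaMono hα hw.subset hpar.symm
  rw [hu, Units.smul_def]
  exact zsmul_mem (Submodule.subset_span (Set.mem_range_self (⟨w, mem_basisWords.2 hw⟩ :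
    basisWords (p + q)))) _

instance : Module.Finite ℝ (Cl p q) :=
  ⟨span_range_basisMono (p := p) (q := q) ▸ Submodule.fg_span (Set.finite_range _)⟩

lemma involute_gammaMono (α : List ℕ) :
    CliffordAlgebra.involute (gammaMono p q α) = (-1 : ℤˣ) ^ α.length • gammaMono p q α := by
  induction α with
  | nil => simp [gammaMono_nil]
  | cons i α ih =>
    rw [gammaMono_cons, map_mul, ih, gamma, CliffordAlgebra.involute_ι, mul_smul_comm, neg_mul,
      List.length_cons, pow_succ, mul_neg_one, Units.neg_smul, smul_neg]

/- A nontrivial monomial is negated by the grade involution if it is odd, and by conjugation with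
any of its letters if it is even. -/
lemma rightTrace_gammaMono_eq_zero (hα : α ⊆ letters (p + q)) (hpar : parity α ≠ 0) :
    rightTrace ℝ (gammaMono p q α) = 0 := by
  rcases Nat.even_or_odd α.length with heven | hodd
  · obtain ⟨i, hi⟩ := Function.ne_iff.1 hpar
    have hiα : [i] ⊆ letters (p + q) := by simpa using hα (mem_of_parity_ne_zero hi)
    have hcount : Odd (α.count i) := ZMod.natCast_ne_zero_iff_odd.1 hi
    refine rightTrace_eq_zero_of_anticommute ℝ (isUnit_gammaMono hiα)
      (anticommute_gammaMono_of_odd ?_)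
    simpa [crossings, coincidences] using heven.add_odd hcount
  · refine eq_zero_of_eq_neg ℝ ?_
    conv_lhs => rw [← rightTrace_algEquiv ℝ CliffordAlgebra.involuteEquiv]
    rw [CliffordAlgebra.involuteEquiv_apply, involute_gammaMono, hodd.neg_one_pow,
      Units.neg_smul, one_smul, map_neg]

lemma rightTrace_conj_basisMono_mul (α β : basisWords (p + q)) :
    rightTrace ℝ (conj (basisMono p q α) * basisMono p q β) =
      if α = β then (Module.finrank ℝ (Cl p q) : ℝ) else 0 := by
  have hα := mem_basisWords.1 α.2
  have hβ := mem_basisWords.1 β.2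
  split_ifs with h
  · rw [← h, basisMono, conj_gammaMono_mul_self hα.subset, rightTrace_one]
  · have hpar : parity (α.1 ++ β.1) ≠ 0 := by
      rw [parity_append]
      exact fun h0 => h <| Subtype.ext <| eq_of_parity_eq ((List.pairwise_lt_range' 1).sublist hα)
        ((List.pairwise_lt_range' 1).sublist hβ) (CharTwo.add_eq_zero.1 h0)
    obtain ⟨u, hu⟩ := exists_gammaMono_mul_self_eq hα.subset
    rw [basisMono, basisMono, conj_gammaMono hα.subset hu, smul_mul_assoc, map_zsmul_unit,
      ← gammaMono_append, rightTrace_gammaMono_eq_zero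
        (List.append_subset.2 ⟨hα.subset, hβ.subset⟩) hpar, smul_zero]

lemma rightTrace_conj_mul_sum_smul (a : basisWords (p + q) → ℝ) :
    rightTrace ℝ (conj (∑ α, a α • basisMono p q α) * ∑ α, a α • basisMono p q α) =
      Module.finrank ℝ (Cl p q) * ∑ α, a α ^ 2 := by
  simp only [map_sum, map_smul, Finset.sum_mul, Finset.mul_sum, smul_mul_assoc, mul_smul_comm,
    rightTrace_conj_basisMono_mul, smul_eq_mul, mul_ite, mul_zero, Finset.sum_ite_eq',
    Finset.mem_univ, if_true]
  exact Finset.sum_congr rfl fun α _ => by ring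

lemma coeff_eq_zero_of_conj_mul_self {a : basisWords (p + q) → ℝ}
    (h : conj (∑ α, a α • basisMono p q α) * ∑ α, a α • basisMono p q α = 0) : a = 0 := by
  have hsum := rightTrace_conj_mul_sum_smul a
  rw [h, map_zero, zero_eq_mul, or_iff_right (Nat.cast_ne_zero.2 Module.finrank_pos.ne'),
    Finset.sum_eq_zero_iff_of_nonneg fun α _ => sq_nonneg (a α)] at hsum
  exact funext fun α => pow_eq_zero_iff two_ne_zero |>.1 (hsum α (Finset.mem_univ α))

lemma eq_zero_of_conj_mul_self {x : Cl p q} (hx : conj x * x = 0) : x = 0 := by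
  have hmem : x ∈ Submodule.span ℝ (Set.range (basisMono p q)) :=
    span_range_basisMono (p := p) (q := q) ▸ Submodule.mem_top
  obtain ⟨a, rfl⟩ := (Submodule.mem_span_range_iff_exists_fun ℝ).1 hmem
  simp [coeff_eq_zero_of_conj_mul_self hx]

lemma finrank_Cl : Module.finrank ℝ (Cl p q) = 2 ^ (p + q) := by
  have hli : LinearIndependent ℝ (basisMono p q) :=
    Fintype.linearIndependent_iff.2 fun a ha =>
      congrFun (coeff_eq_zero_of_conj_mul_self (by rw [ha, mul_zero]))
  rw [← finrank_top, ← span_range_basisMono, finrank_span_eq_card hli, Fintype.card_coe,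
    card_basisWords]

end Basis

section Families

variable {p q : ℕ} {L : List (List ℕ)} {α β : List ℕ}

/-- The parity vectors of the words in a family are linearly independent over `𝔽₂`: no nonempty
subfamily has sum zero. -/
def IsIndependent (L : List (List ℕ)) : Prop :=
  ∀ T, T.Sublist L → parity T.flatten = 0 → T = []

/-- `γ_β` is an involution commuting with the monomials of the family. -/
structure IsCompatible (p q : ℕ) (L : List (List ℕ)) (β : List ℕ) : Prop where
  mul_self : gammaMono p q β * gammaMono p q β = 1
  commute : ∀ α ∈ L, Commute (gammaMono p q α) (gammaMono p q β)

/-- Every monomial in the letters `A` that is compatible with the family is, up to sign, a product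
of monomials of the family. -/
def IsMaximal (p q : ℕ) (A : List ℕ) (L : List (List ℕ)) : Prop :=
  ∀ β ⊆ A, IsCompatible p q L β →
    ∃ T : List (List ℕ), T.Sublist L ∧ parity T.flatten = parity β

lemma flatten_subset_of_sublist {T : List (List ℕ)} (hL : ∀ α ∈ L, α ⊆ β) (hT : T.Sublist L) :
    T.flatten ⊆ β := by
  intro i hi
  obtain ⟨α, hα, hiα⟩ := List.mem_flatten.1 hi
  exact hL α (hT.subset hα) hiα

lemma idem_eq_halfSumProd (L : List (List ℕ)) :
    idem p q L = halfSumProd ℝ (L.map (gammaMono p q)) := by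
  rw [idem, halfSumProd, List.map_map]
  rfl

lemma idem_cons (α : List ℕ) (L : List (List ℕ)) :
    idem p q (α :: L) = (1 / 2 : ℝ) • ((1 + gammaMono p q α) * idem p q L) := by
  simp only [idem_eq_halfSumProd, List.map_cons, halfSumProd_cons]

lemma isIdempotentElem_idem (hinv : IsCommutingInvolutions (L.map (gammaMono p q))) :
    IsIdempotentElem (idem p q L) :=
  idem_eq_halfSumProd (p := p) (q := q) L ▸ isIdempotentElem_halfSumProd ℝ hinv

lemma IsIndependent.sublist {M : List (List ℕ)} (hind : IsIndependent L) (hM : M.Sublist L) :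
    IsIndependent M :=
  fun T hT => hind T (hT.trans hM)

lemma IsIndependent.parity_ne (hind : IsIndependent (α :: L)) {T : List (List ℕ)}
    (hT : T.Sublist L) : parity T.flatten ≠ parity α := fun hpar =>
  List.cons_ne_nil α T <| hind _ (hT.cons_cons α) <| by
    rw [List.flatten_cons, parity_append, hpar, CharTwo.add_self_eq_zero]

lemma rightTrace_gammaMono_mul_idem_eq_zero (hL : ∀ α ∈ L, α ⊆ letters (p + q))
    (hβ : β ⊆ letters (p + q))
    (hne : ∀ T : List (List ℕ), T.Sublist L → parity T.flatten ≠ parity β) :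
    rightTrace ℝ (gammaMono p q β * idem p q L) = 0 := by
  induction L generalizing β with
  | nil =>
    simpa [idem] using rightTrace_gammaMono_eq_zero hβ fun h =>
      hne [] (List.Sublist.refl _) (by rw [h, List.flatten_nil, parity_nil])
  | cons α L ih =>
    rw [List.forall_mem_cons] at hL
    have hβα : rightTrace ℝ (gammaMono p q (β ++ α) * idem p q L) = 0 := by
      refine ih hL.2 (List.append_subset.2 ⟨hβ, hL.1⟩) fun T hT hpar => ?_
      refine hne (α :: T) (hT.cons_cons α) ?_
      rw [List.flatten_cons, parity_append, hpar, parity_append, add_comm, add_assoc,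
        CharTwo.add_self_eq_zero, add_zero]
    rw [idem_cons, mul_smul_comm, ← mul_assoc, mul_add, mul_one, add_mul, ← gammaMono_append,
      map_smul, map_add, hβα, ih hL.2 hβ fun T hT => hne T (hT.cons α), add_zero, smul_zero]

lemma rightTrace_idem (hL : ∀ α ∈ L, α ⊆ letters (p + q)) (hind : IsIndependent L) :
    rightTrace ℝ (idem p q L) = 2 ^ (p + q) / 2 ^ L.length := by
  induction L with
  | nil => simp [idem, rightTrace_one, finrank_Cl]
  | cons α L ih =>
    rw [List.forall_mem_cons] at hL
    rw [idem_cons, add_mul, one_mul, map_smul, map_add,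
      ih hL.2 (hind.sublist (List.sublist_cons_self α L)),
      rightTrace_gammaMono_mul_idem_eq_zero hL.2 hL.1 fun T hT => hind.parity_ne hT,
      List.length_cons, pow_succ, smul_eq_mul]
    ring

lemma idem_ne_zero (hL : ∀ α ∈ L, α ⊆ letters (p + q)) (hind : IsIndependent L) :
    idem p q L ≠ 0 := by
  intro h
  have htrace := rightTrace_idem hL hind
  rw [h, map_zero] at htrace
  exact absurd htrace.symm (by positivity)

lemma finrank_leftIdeal_idem_mul (hL : ∀ α ∈ L, α ⊆ letters (p + q))
    (hinv : IsCommutingInvolutions (L.map (gammaMono p q))) (hind : IsIndependent L) :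
    Module.finrank ℝ (leftIdeal (idem p q L)) * 2 ^ L.length = 2 ^ (p + q) := by
  have hrank := finrank_leftIdeal ℝ (isIdempotentElem_idem hinv)
  rw [rightTrace_idem hL hind, eq_div_iff (by positivity)] at hrank
  exact_mod_cast hrank

lemma length_le_of_isIndependent (hL : ∀ α ∈ L, α ⊆ letters (p + q))
    (hinv : IsCommutingInvolutions (L.map (gammaMono p q))) (hind : IsIndependent L) :
    L.length ≤ p + q :=
  (Nat.pow_dvd_pow_iff_le_right one_lt_two).1
    (Dvd.intro_left _ (finrank_leftIdeal_idem_mul hL hinv hind))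

lemma finrank_leftIdeal_idem (hL : ∀ α ∈ L, α ⊆ letters (p + q))
    (hinv : IsCommutingInvolutions (L.map (gammaMono p q))) (hind : IsIndependent L) :
    Module.finrank ℝ (leftIdeal (idem p q L)) = 2 ^ (p + q - L.length) := by
  rw [← Nat.pow_div (length_le_of_isIndependent hL hinv hind) two_pos,
    ← finrank_leftIdeal_idem_mul hL hinv hind, Nat.mul_div_cancel _ (by positivity)]

lemma parity_eq_of_gammaMono_eq (hα : α ⊆ letters (p + q)) (hβ : β ⊆ letters (p + q))
    (h : gammaMono p q α = gammaMono p q β) : parity α = parity β := by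
  rw [← CharTwo.add_eq_zero, ← parity_append]
  by_contra hpar
  obtain ⟨u, hu⟩ := exists_gammaMono_mul_self_eq hβ
  have htrace := rightTrace_gammaMono_eq_zero (List.append_subset.2 ⟨hα, hβ⟩) hpar
  rw [gammaMono_append, h, hu, map_zsmul_unit, rightTrace_one, smul_eq_zero_iff_eq] at htrace
  exact Module.finrank_pos.ne' (Nat.cast_eq_zero.1 htrace)

lemma ncard_gammaSet (hL : ∀ α ∈ L, α ⊆ letters (p + q)) (hind : IsIndependent L) :
    (gammaSet p q L).ncard = L.length := by
  classical
  have hnodup : (L.map (gammaMono p q)).Nodup := by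
    rw [List.Nodup, List.pairwise_map, List.pairwise_iff_forall_sublist]
    intro α β hαβ h
    have hmem := hαβ.subset
    refine List.cons_ne_nil α [β] (hind _ hαβ ?_)
    rw [List.flatten_cons, List.flatten_singleton, parity_append, CharTwo.add_eq_zero]
    exact parity_eq_of_gammaMono_eq (hL α (hmem (by simp))) (hL β (hmem (by simp))) h
  have hset : gammaSet p q L = (L.map (gammaMono p q)).toFinset := by
    ext g; simp [gammaSet]
  rw [hset, Set.ncard_coe_finset, List.toFinset_card_of_nodup hnodup, List.length_map]

/- Dropping a generator that is a product of others would not change the idempotent, but it doubles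
the trace. -/
lemma gammaMono_notMem_closure (hL : ∀ α ∈ L, α ⊆ letters (p + q))
    (hinv : IsCommutingInvolutions (L.map (gammaMono p q))) (hind : IsIndependent L)
    (hα : α ∈ L) :
    gammaMono p q α ∉ Submonoid.closure (gammaSet p q L \ {gammaMono p q α}) := by
  intro hcl
  set hs := (L.erase α).map (gammaMono p q)
  have hsub : hs ⊆ L.map (gammaMono p q) := List.map_subset _ List.erase_subset
  have hmem : ∀ β ∈ L, gammaMono p q β ≠ gammaMono p q α → gammaMono p q β ∈ hs :=
    fun β hβ hne => List.mem_map_of_mem ((List.mem_erase_of_ne fun h => hne (by rw [h])).2 hβ)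
  have hle : Submonoid.closure (gammaSet p q L \ {gammaMono p q α}) ≤
      Submonoid.closure {h | h ∈ hs} := by
    refine Submonoid.closure_mono ?_
    rintro _ ⟨⟨β, hβ, rfl⟩, hne⟩
    exact hmem β hβ hne
  have hidem : idem p q L = idem p q (L.erase α) := by
    rw [idem_eq_halfSumProd, idem_eq_halfSumProd]
    refine halfSumProd_eq_of_subset ℝ hinv hsub fun g hg => ?_
    obtain ⟨β, hβ, rfl⟩ := List.mem_map.1 hg
    by_cases h : gammaMono p q β = gammaMono p q α
    · exact h ▸ hle hcl
    · exact Submonoid.subset_closure (hmem β hβ h)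
  have htrace := rightTrace_idem hL hind
  rw [hidem, rightTrace_idem (fun β hβ => hL β (List.mem_of_mem_erase hβ))
    (hind.sublist List.erase_sublist), div_eq_div_iff (by positivity) (by positivity),
    mul_right_inj' (by positivity), List.length_erase_of_mem hα] at htrace
  have hlen := pow_right_injective₀ (zero_lt_two' ℝ) (by norm_num) htrace
  have := List.length_pos_of_mem hα
  omega

end Families

section Minimality

variable {p q : ℕ} {L : List (List ℕ)}

lemma gammaMono_flatten_mul_idem (hinv : IsCommutingInvolutions (L.map (gammaMono p q)))
    {T : List (List ℕ)} (hT : T ⊆ L) :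
    gammaMono p q T.flatten * idem p q L = idem p q L := by
  induction T with
  | nil => rw [List.flatten_nil, gammaMono_nil, one_mul]
  | cons α T ih =>
    rw [List.cons_subset] at hT
    rw [List.flatten_cons, gammaMono_append, mul_assoc, ih hT.2, idem_eq_halfSumProd]
    exact mul_halfSumProd_of_mem ℝ hinv (List.mem_map_of_mem hT.1)

lemma conj_idem (hL : ∀ α ∈ L, α ⊆ letters (p + q))
    (hinv : IsCommutingInvolutions (L.map (gammaMono p q))) :
    conj (idem p q L) = idem p q L := by
  rw [idem_eq_halfSumProd]
  refine map_halfSumProd_of_antimultiplicative ℝ hinv conj conj_one conj_mul fun g hg => ?_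
  obtain ⟨α, hα, rfl⟩ := List.mem_map.1 hg
  rw [conj_gammaMono (u := 1) (hL α hα) (by rw [hinv.mul_self _ hg, one_smul]), one_smul]

lemma exists_idem_mul_gammaMono_add_conj_mul_idem (hL : ∀ α ∈ L, α ⊆ letters (p + q))
    (hinv : IsCommutingInvolutions (L.map (gammaMono p q)))
    (hmax : IsMaximal p q (letters (p + q)) L)
    {β : List ℕ} (hβ : β ⊆ letters (p + q)) :
    ∃ c : ℝ, idem p q L * (gammaMono p q β + conj (gammaMono p q β)) * idem p q L =
      c • idem p q L := by
  obtain ⟨u, hu⟩ := exists_gammaMono_mul_self_eq hβ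
  rw [conj_gammaMono hβ hu]
  rcases Int.units_eq_one_or u with rfl | rfl
  · rw [one_smul] at hu ⊢
    by_cases hcomm : ∀ α ∈ L, Commute (gammaMono p q α) (gammaMono p q β)
    · obtain ⟨T, hT, hpar⟩ := hmax β hβ ⟨hu, hcomm⟩
      obtain ⟨v, hv⟩ := exists_gammaMono_eq_smul_gammaMono hβ
        (flatten_subset_of_sublist hL hT) hpar.symm
      have hfix : gammaMono p q β * idem p q L = ((v : ℤ) : ℝ) • idem p q L := by
        rw [hv, smul_mul_assoc, gammaMono_flatten_mul_idem hinv hT.subset, Units.smul_def,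
          Int.cast_smul_eq_zsmul]
      refine ⟨(v : ℤ) + (v : ℤ), ?_⟩
      rw [mul_assoc, add_mul, hfix, ← add_smul, mul_smul_comm, (isIdempotentElem_idem hinv).eq]
    · push Not at hcomm
      obtain ⟨α, hα, hαβ⟩ := hcomm
      have hanti := anticommute_gammaMono_of_odd (p := p) (q := q) <| Nat.not_even_iff_odd.1 <|
        mt (commute_gammaMono_iff (hL α hα) hβ).2 hαβ
      have hzero := halfSumProd_mul_mul_halfSumProd_of_anticommute ℝ hinv
        (List.mem_map_of_mem hα) hanti
      exact ⟨0, by rw [idem_eq_halfSumProd, mul_add, add_mul, hzero, add_zero, zero_smul]⟩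
  · exact ⟨0, by rw [Units.neg_smul, one_smul, add_neg_cancel, mul_zero, zero_mul, zero_smul]⟩

lemma exists_idem_mul_add_conj_mul_idem (hL : ∀ α ∈ L, α ⊆ letters (p + q))
    (hinv : IsCommutingInvolutions (L.map (gammaMono p q)))
    (hmax : IsMaximal p q (letters (p + q)) L)
    (x : Cl p q) :
    ∃ c : ℝ, idem p q L * (x + conj x) * idem p q L = c • idem p q L := by
  have hx := span_gammaMono (p := p) (q := q) ▸ Submodule.mem_top (x := x)
  induction hx using Submodule.span_induction with
  | mem x hx =>
    obtain ⟨β, hβ, rfl⟩ := hx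
    exact exists_idem_mul_gammaMono_add_conj_mul_idem hL hinv hmax hβ
  | zero => exact ⟨0, by simp⟩
  | add x y _ _ hx hy =>
    obtain ⟨a, ha⟩ := hx
    obtain ⟨b, hb⟩ := hy
    exact ⟨a + b, by rw [map_add, add_add_add_comm, mul_add, add_mul, ha, hb, add_smul]⟩
  | smul c x _ hx =>
    obtain ⟨a, ha⟩ := hx
    exact ⟨c * a, by rw [map_smul, ← smul_add, mul_smul_comm, smul_mul_assoc, ha, mul_smul]⟩

lemma isAtom_leftIdeal_idem (hL : ∀ α ∈ L, α ⊆ letters (p + q))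
    (hinv : IsCommutingInvolutions (L.map (gammaMono p q))) (hind : IsIndependent L)
    (hmax : IsMaximal p q (letters (p + q)) L) : IsAtom (leftIdeal (idem p q L)) :=
  isAtom_leftIdeal (isIdempotentElem_idem hinv) (idem_ne_zero hL hind) fun _ hx₀ hx =>
    exists_mul_eq_of_corner_subset_span conj conj_mul conj_conj
      (fun _ => eq_zero_of_conj_mul_self) (conj_idem hL hinv)
      (exists_idem_mul_add_conj_mul_idem hL hinv hmax) hx₀ hx

end Minimality

section Codes

variable {K L M : List (List ℕ)} {U V : Set ℕ} {α β : List ℕ} {f : ℕ → ℕ} {i j : ℕ}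

lemma parity_map (hf : f.Injective) (α : List ℕ) (i : ℕ) : parity (α.map f) (f i) = parity α i := by
  rw [parity, List.count_map_of_injective _ _ hf, parity]

lemma parity_map_eq_zero (hi : i ∉ Set.range f) : parity (α.map f) i = 0 := by
  by_contra h
  obtain ⟨j, -, rfl⟩ := List.mem_map.1 (mem_of_parity_ne_zero h)
  exact hi ⟨j, rfl⟩

lemma parity_map_eq_parity_map (hf : f.Injective) (h : parity α = parity β) :
    parity (α.map f) = parity (β.map f) := by
  ext i
  by_cases hi : i ∈ Set.range f
  · obtain ⟨j, rfl⟩ := hi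
    rw [parity_map hf, parity_map hf, h]
  · rw [parity_map_eq_zero hi, parity_map_eq_zero hi]

lemma coincidences_map (hf : f.Injective) (α β : List ℕ) :
    coincidences (α.map f) (β.map f) = coincidences α β := by
  rw [coincidences, List.map_map, coincidences]
  simp only [Function.comp_def, List.count_map_of_injective _ _ hf]

lemma crossings_map (hf : f.Injective) (α β : List ℕ) :
    crossings (α.map f) (β.map f) = crossings α β := by
  rw [crossings, List.length_map, List.length_map, coincidences_map hf, crossings]

lemma natCast_coincidences (α β : List ℕ) :
    (coincidences α β : ZMod 2) = (α.map (parity β)).sum := by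
  rw [coincidences, Nat.cast_list_sum, List.map_map]
  rfl

lemma coincidences_eq_zero_of_disjoint (h : α.Disjoint β) : coincidences α β = 0 := by
  rw [coincidences, List.sum_eq_zero_iff, List.forall_mem_map]
  exact fun i hi => List.count_eq_zero_of_not_mem (h hi)

lemma IsIndependent.map (hL : IsIndependent L) (hf : f.Injective) :
    IsIndependent (L.map (List.map f)) := by
  intro T hT hpar
  obtain ⟨S, hS, rfl⟩ := List.sublist_map_iff.1 hT
  refine List.map_eq_nil_iff.2 (hL S hS (funext fun i => ?_))
  rw [← parity_map hf, List.map_flatten, hpar, Pi.zero_apply, Pi.zero_apply]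

lemma IsIndependent.append (hL : IsIndependent L) (hM : IsIndependent M)
    (hLM : ∀ α ∈ L, ∀ β ∈ M, α.Disjoint β) : IsIndependent (L ++ M) := by
  intro T hT hpar
  obtain ⟨T₁, T₂, rfl, h₁, h₂⟩ := List.sublist_append_iff.1 hT
  have hdisj : T₁.flatten.Disjoint T₂.flatten := by
    intro i hi hi'
    obtain ⟨α, hα, hiα⟩ := List.mem_flatten.1 hi
    obtain ⟨β, hβ, hiβ⟩ := List.mem_flatten.1 hi'
    exact hLM α (h₁.subset hα) β (h₂.subset hβ) hiα hiβ
  rw [List.flatten_append, parity_append] at hpar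
  have hpar₁ : parity T₁.flatten = 0 := by
    ext i
    by_contra hi
    have hi₂ : parity T₂.flatten i = 0 :=
      not_not.1 fun h => hdisj (mem_of_parity_ne_zero hi) (mem_of_parity_ne_zero h)
    exact hi (by rw [← hpar, Pi.add_apply, hi₂, add_zero])
  rw [hpar₁, zero_add] at hpar
  rw [hL T₁ h₁ hpar₁, hM T₂ h₂ hpar, List.append_nil]

/-- A basis, given by words of even length in the letters `U`, of a binary code in `𝔽₂^U` that
is equal to its dual. -/
structure IsSelfDualBlock (K : List (List ℕ)) (U : Set ℕ) : Prop where
  even_length : ∀ α ∈ K, Even α.length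
  mem : ∀ α ∈ K, ∀ i ∈ α, i ∈ U
  even_coincidences : ∀ α ∈ K, ∀ β ∈ K, Even (coincidences α β)
  independent : IsIndependent K
  dual : ∀ x : ℕ → ZMod 2, (∀ α ∈ K, (α.map x).sum = 0) →
    ∃ T : List (List ℕ), T.Sublist K ∧ ∀ i ∈ U, x i = parity T.flatten i

lemma IsSelfDualBlock.nil : IsSelfDualBlock [] ∅ where
  even_length := by simp
  mem := by simp
  even_coincidences := by simp
  independent _ hT _ := List.sublist_nil.1 hT
  dual _ _ := ⟨[], List.Sublist.refl _, by simp⟩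

lemma IsSelfDualBlock.disjoint (hK : IsSelfDualBlock K U) (hM : IsSelfDualBlock M V)
    (hUV : Disjoint U V) : ∀ α ∈ K, ∀ β ∈ M, α.Disjoint β := fun α hα β hβ i hi hi' =>
  Set.disjoint_left.1 hUV (hK.mem α hα i hi) (hM.mem β hβ i hi')

lemma IsSelfDualBlock.parity_flatten_eq_zero (hK : IsSelfDualBlock K U) {T : List (List ℕ)}
    (hT : T.Sublist K) (hi : i ∉ U) : parity T.flatten i = 0 := by
  by_contra h
  obtain ⟨α, hα, hiα⟩ := List.mem_flatten.1 (mem_of_parity_ne_zero h)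
  exact hi (hK.mem α (hT.subset hα) i hiα)

lemma IsSelfDualBlock.append (hK : IsSelfDualBlock K U) (hM : IsSelfDualBlock M V)
    (hUV : Disjoint U V) : IsSelfDualBlock (K ++ M) (U ∪ V) where
  even_length := List.forall_mem_append.2 ⟨hK.even_length, hM.even_length⟩
  mem := List.forall_mem_append.2
    ⟨fun α hα i hi => Or.inl (hK.mem α hα i hi), fun α hα i hi => Or.inr (hM.mem α hα i hi)⟩
  even_coincidences := by
    have hdisj := hK.disjoint hM hUV
    simp only [List.forall_mem_append]
    refine ⟨fun α hα => ⟨hK.even_coincidences α hα, fun β hβ => ?_⟩,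
      fun α hα => ⟨fun β hβ => ?_, hM.even_coincidences α hα⟩⟩
    · rw [coincidences_eq_zero_of_disjoint (hdisj α hα β hβ)]
      exact Even.zero
    · rw [coincidences_eq_zero_of_disjoint (hdisj β hβ α hα).symm]
      exact Even.zero
  independent := hK.independent.append hM.independent (hK.disjoint hM hUV)
  dual x hx := by
    rw [List.forall_mem_append] at hx
    obtain ⟨S, hS, hSx⟩ := hK.dual x hx.1
    obtain ⟨T, hT, hTx⟩ := hM.dual x hx.2
    refine ⟨S ++ T, hS.append hT, ?_⟩
    rw [List.flatten_append, parity_append]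
    rintro i (hi | hi)
    · rw [Pi.add_apply, ← hSx i hi,
        hM.parity_flatten_eq_zero hT (Set.disjoint_left.1 hUV hi), add_zero]
    · rw [Pi.add_apply, ← hTx i hi,
        hK.parity_flatten_eq_zero hS (Set.disjoint_right.1 hUV hi), zero_add]

lemma IsSelfDualBlock.map (hK : IsSelfDualBlock K U) (hf : f.Injective) :
    IsSelfDualBlock (K.map (List.map f)) (f '' U) where
  even_length := by
    simpa only [List.forall_mem_map, List.length_map] using hK.even_length
  mem := by
    simpa only [List.forall_mem_map, hf.mem_set_image] using hK.mem
  even_coincidences := by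
    simpa only [List.forall_mem_map, coincidences_map hf] using hK.even_coincidences
  independent := hK.independent.map hf
  dual x hx := by
    simp only [List.forall_mem_map, List.map_map] at hx
    obtain ⟨T, hT, hTx⟩ := hK.dual (x ∘ f) hx
    refine ⟨T.map (List.map f), hT.map _, ?_⟩
    rintro _ ⟨i, hi, rfl⟩
    rw [← List.map_flatten, parity_map hf, ← hTx i hi, Function.comp_apply]

lemma isSelfDualBlock_pair (hij : i ≠ j) : IsSelfDualBlock [[i, j]] {i, j} where
  even_length := by simp
  mem := by simp
  even_coincidences := by simp [coincidences, List.count_cons, hij, hij.symm]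
  independent T hT hpar := by
    rcases List.sublist_singleton.1 hT with rfl | rfl
    · rfl
    · have hi := congrFun hpar i
      simp [parity, hij.symm] at hi
  dual x hx := by
    have hx₀ : x i + x j = 0 := by simpa using hx
    rcases eq_or_ne (x i) 0 with hi | hi
    · exact ⟨[], List.nil_sublist _, by simp_all [parity]⟩
    · have hone : ∀ y : ZMod 2, y ≠ 0 → y = 1 := by decide
      have hj : x j = 1 := by rw [← CharTwo.add_eq_zero.1 hx₀, hone _ hi]
      exact ⟨[[i, j]], List.Sublist.refl _, by simp [parity, hone _ hi, hj, hij, hij.symm]⟩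

/-- A basis of the extended Hamming code of length `8`. -/
def octet : List (List ℕ) := [[1, 2, 3, 4], [1, 2, 5, 6], [1, 2, 7, 8], [1, 3, 5, 7]]

lemma octet_dual : ∀ w ∈ (letters 8).sublists, (∀ α ∈ octet, (α.map (parity w)).sum = 0) →
    ∃ T ∈ octet.sublists, ∀ i ∈ letters 8, parity w i = parity T.flatten i := by
  decide +kernel

lemma octet_independent : ∀ T ∈ octet.sublists,
    (∀ i ∈ letters 8, parity T.flatten i = 0) → T = [] := by
  decide +kernel

lemma isSelfDualBlock_octet : IsSelfDualBlock octet {i | i ∈ letters 8} where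
  even_length := by decide
  mem := by decide
  even_coincidences := by decide
  independent T hT hpar := octet_independent T (List.mem_sublists.2 hT) fun i _ => congrFun hpar i
  dual x hx := by
    obtain ⟨w, hw, hwx⟩ := exists_sublist_parity_eq (l := letters 8) List.nodup_range'
      (v := fun i => if i ∈ letters 8 then x i else 0) (by simp +contextual)
    have hx_eq : ∀ i ∈ letters 8, parity w i = x i := fun i hi => by simp only [hwx, if_pos hi]
    have hsubset : ∀ α ∈ octet, α ⊆ letters 8 := by decide
    obtain ⟨T, hT, hTw⟩ := octet_dual w (List.mem_sublists.2 hw) fun α hα => by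
      rw [List.map_congr_left fun i hi => hx_eq i (hsubset α hα hi), hx α hα]
    exact ⟨T, List.mem_sublists.1 hT, fun i hi => by rw [← hx_eq i hi, hTw i hi]⟩

lemma pairs_succ (m s : ℕ) : pairs (m + 1) s = pairs m s ++ [[m + 1, s + (m + 1)]] := by
  simp only [pairs, List.range_succ, List.map_append, List.map_singleton]

lemma quads_succ (s l : ℕ) :
    quads s (l + 1) = quads s l ++ octet.map (List.map (s + 8 * l + ·)) := by
  simp [quads, List.range_succ, octet]

lemma isSelfDualBlock_pairs {m s : ℕ} (hms : m ≤ s) :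
    IsSelfDualBlock (pairs m s) (Set.Icc 1 m ∪ Set.Icc (s + 1) (s + m)) := by
  induction m with
  | zero => simpa [pairs] using IsSelfDualBlock.nil
  | succ m ih =>
    rw [pairs_succ]
    convert (ih (by omega)).append (isSelfDualBlock_pair (i := m + 1) (j := s + (m + 1))
      (by omega)) ?_ using 1
    · grind
    · simp only [Set.disjoint_left]
      grind

lemma isSelfDualBlock_quads (s l : ℕ) :
    IsSelfDualBlock (quads s l) (Set.Icc (s + 1) (s + 8 * l)) := by
  induction l with
  | zero => simpa [quads] using IsSelfDualBlock.nil
  | succ l ih =>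
    rw [quads_succ]
    convert ih.append (isSelfDualBlock_octet.map (add_right_injective (s + 8 * l))) ?_ using 1
    · ext i
      simp only [Set.mem_union, Set.mem_Icc, Set.mem_image, Set.mem_ofPred_eq, List.mem_range'_1]
      refine ⟨fun h => or_iff_not_imp_left.2 fun h' => ⟨i - (s + 8 * l), ?_, ?_⟩, ?_⟩ <;> grind
    · simp only [Set.disjoint_left, Set.mem_Icc, Set.mem_image, List.mem_range'_1]
      grind

end Codes

section Assembly

variable {p q m a : ℕ} {ε : ℤˣ} {α β A : List ℕ} {K L E : List (List ℕ)} {U : Set ℕ}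

lemma IsCompatible.append (hα : IsCompatible p q L α) (hβ : IsCompatible p q L β)
    (hαβ : Commute (gammaMono p q α) (gammaMono p q β)) : IsCompatible p q L (α ++ β) where
  mul_self := by
    rw [gammaMono_append, hαβ.symm.mul_mul_mul_comm, hα.mul_self, hβ.mul_self, one_mul]
  commute δ hδ := by
    rw [gammaMono_append]
    exact (hα.commute δ hδ).mul_right (hβ.commute δ hδ)

lemma IsCompatible.of_parity_eq (hα : IsCompatible p q L α) (hαsub : α ⊆ letters (p + q))
    (hβsub : β ⊆ letters (p + q)) (hpar : parity β = parity α) : IsCompatible p q L β := by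
  obtain ⟨u, hu⟩ := exists_gammaMono_eq_smul_gammaMono hβsub hαsub hpar
  refine ⟨?_, fun δ hδ => hu ▸ (hα.commute δ hδ).smul_right u⟩
  rw [hu, smul_mul_smul_comm, Int.units_mul_self, one_smul, hα.mul_self]

lemma commute_gammaMono_flatten {T : List (List ℕ)} {x : Cl p q}
    (hx : ∀ α ∈ T, Commute x (gammaMono p q α)) : Commute x (gammaMono p q T.flatten) := by
  induction T with
  | nil => exact Commute.one_right x
  | cons α T ih =>
    rw [List.forall_mem_cons] at hx
    rw [List.flatten_cons, gammaMono_append]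
    exact hx.1.mul_right (ih hx.2)

lemma isCompatible_flatten (hinv : IsCommutingInvolutions (L.map (gammaMono p q)))
    {T : List (List ℕ)} (hT : T ⊆ L) : IsCompatible p q L T.flatten := by
  have hcomm : ∀ α ∈ L, ∀ β ∈ L, Commute (gammaMono p q α) (gammaMono p q β) := fun α hα β hβ =>
    hinv.commute _ (List.mem_map_of_mem hα) _ (List.mem_map_of_mem hβ)
  induction T with
  | nil => exact ⟨mul_one 1, fun _ _ => Commute.one_right _⟩
  | cons α T ih =>
    rw [List.cons_subset] at hT
    exact IsCompatible.append
      ⟨hinv.mul_self _ (List.mem_map_of_mem hT.1), fun β hβ => hcomm β hβ α hT.1⟩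
      (ih hT.2) ((ih hT.2).commute α hT.1)

lemma parity_filter_mem (hα : ∀ i ∉ A, parity α i = 0) :
    parity (α.filter (· ∈ A)) = parity α := by
  ext i
  by_cases hi : i ∈ A
  · rw [parity, List.count_filter (by simpa using hi), parity]
  · rw [hα i hi]
    exact not_not.1 fun h => hi (by simpa using (List.mem_filter.1 (mem_of_parity_ne_zero h)).2)

/- A compatible word can be multiplied by a word of the self-dual part that cancels its letters
outside `A`, because commuting with the self-dual part means being orthogonal to it. -/
lemma IsMaximal.append (hK : IsSelfDualBlock K U) (hE : IsMaximal p q A E)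
    (hsub : ∀ α ∈ K ++ E, α ⊆ letters (p + q))
    (hinv : IsCommutingInvolutions ((K ++ E).map (gammaMono p q)))
    (hcover : ∀ i ∈ letters (p + q), i ∉ A → i ∈ U) :
    IsMaximal p q (letters (p + q)) (K ++ E) := by
  intro β hβ hβL
  obtain ⟨S, hS, hSβ⟩ := hK.dual (parity β) fun α hα => by
    have hαL : α ∈ K ++ E := List.mem_append_left E hα
    have hcross := (commute_gammaMono_iff (hsub α hαL) hβ).1 (hβL.commute α hαL)
    rw [crossings, Nat.even_add] at hcross
    rw [← natCast_coincidences, ZMod.natCast_eq_zero_iff_even]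
    exact hcross.1 ((hK.even_length α hα).mul_right _)
  have hSL : S.Sublist (K ++ E) := hS.trans (List.sublist_append_left K E)
  have hδsub : β ++ S.flatten ⊆ letters (p + q) :=
    List.append_subset.2 ⟨hβ, flatten_subset_of_sublist hsub hSL⟩
  have hδ : IsCompatible p q (K ++ E) (β ++ S.flatten) :=
    hβL.append (isCompatible_flatten hinv hSL.subset) <|
      commute_gammaMono_flatten fun α hα => (hβL.commute α (hSL.subset hα)).symm
  have hpar : parity ((β ++ S.flatten).filter (· ∈ A)) = parity (β ++ S.flatten) := by
    refine parity_filter_mem fun i hi => not_not.1 fun h => h ?_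
    have hiU := hcover i (hδsub (mem_of_parity_ne_zero h)) hi
    rw [parity_append, Pi.add_apply, hSβ i hiU, CharTwo.add_self_eq_zero]
  have hw := hδ.of_parity_eq hδsub
    (List.Subset.trans (List.filter_subset_self _) hδsub) hpar
  obtain ⟨T, hT, hTw⟩ := hE _ (fun i hi => by simpa using (List.mem_filter.1 hi).2)
    ⟨hw.mul_self, fun α hα => hw.commute α (List.mem_append_right K hα)⟩
  refine ⟨S ++ T, hS.append hT, ?_⟩
  rw [List.flatten_append, parity_append, hTw, hpar, parity_append, add_left_comm,
    CharTwo.add_self_eq_zero, add_zero]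

lemma IsBasisIndex.nodup {n : ℕ} (hα : IsBasisIndex n α) : α.Nodup := hα.1.nodup

lemma IsBasisIndex.subset_letters {n : ℕ} (hα : IsBasisIndex n α) : α ⊆ letters n := fun i hi =>
  List.mem_range'_1.2 ⟨(hα.2.1 i hi).1, by have := (hα.2.1 i hi).2; omega⟩

lemma IsBasisIndex.map_add {n : ℕ} (hα : IsBasisIndex a α) (hn : m + a ≤ n) :
    IsBasisIndex n (α.map (m + ·)) := by
  refine ⟨hα.1.map _ fun _ _ h => Nat.add_lt_add_left h m, ?_, ?_⟩
  · rw [List.forall_mem_map]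
    intro i hi
    have := hα.2.1 i hi
    omega
  · rw [List.length_map]
    exact hα.2.2

/-- The square of a product of `r` distinct generators each of square `ε`. -/
def squareSign (ε : ℤˣ) (r : ℕ) : ℤˣ := (-1) ^ r.choose 2 * ε ^ r

lemma gammaMono_mul_self_eq_one_iff (hα : α ⊆ letters (p + q)) (hnodup : α.Nodup)
    (hε : ∀ i ∈ α, genSign p i = ε) :
    gammaMono p q α * gammaMono p q α = 1 ↔ squareSign ε α.length = 1 := by
  have hprod : (α.map (genSign p)).prod = ε ^ α.length := by
    rw [List.map_congr_left hε, List.map_const', List.prod_replicate]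
  rw [gammaMono_mul_self_of_nodup hα hnodup, hprod, ← squareSign]
  refine ⟨fun h => ?_, fun h => by rw [h, one_smul]⟩
  rcases Int.units_eq_one_or (squareSign ε α.length) with hsign | hsign
  · exact hsign
  · rw [hsign, Units.neg_smul, one_smul] at h
    exact absurd (eq_zero_of_eq_neg ℝ h.symm) one_ne_zero

/-- A family of words in the letters `1, …, a` whose monomials are independent commuting
involutions, maximal with this property, whenever all `a` generators have square `ε`. -/
structure IsMaximalCode (ε : ℤˣ) (a : ℕ) (E : List (List ℕ)) : Prop where
  basisIndex : ∀ α ∈ E, IsBasisIndex a α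
  squareSign_length : ∀ α ∈ E, squareSign ε α.length = 1
  even_crossings : ∀ α ∈ E, ∀ β ∈ E, Even (crossings α β)
  independent : IsIndependent E
  maximal : ∀ w : List ℕ, w.Sublist (letters a) → (∀ α ∈ E, Even (crossings α w)) →
    squareSign ε w.length = 1 → ∃ T : List (List ℕ), T.Sublist E ∧ parity T.flatten = parity w

lemma IsMaximalCode.of_mem_sublists (hbasis : ∀ α ∈ E, IsBasisIndex a α)
    (hsign : ∀ α ∈ E, squareSign ε α.length = 1)
    (hcross : ∀ α ∈ E, ∀ β ∈ E, Even (crossings α β))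
    (hind : ∀ T ∈ E.sublists, (∀ i ∈ letters a, parity T.flatten i = 0) → T = [])
    (hmax : ∀ w ∈ (letters a).sublists, (∀ α ∈ E, Even (crossings α w)) →
      squareSign ε w.length = 1 →
        ∃ T ∈ E.sublists, ∀ i ∈ letters a, parity T.flatten i = parity w i) :
    IsMaximalCode ε a E where
  basisIndex := hbasis
  squareSign_length := hsign
  even_crossings := hcross
  independent T hT hpar := hind T (List.mem_sublists.2 hT) fun i _ => congrFun hpar i
  maximal w hw hwE hsq := by
    obtain ⟨T, hT, hTw⟩ := hmax w (List.mem_sublists.2 hw) hwE hsq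
    rw [List.mem_sublists] at hT
    have hTsub := flatten_subset_of_sublist (fun α hα => (hbasis α hα).subset_letters) hT
    refine ⟨T, hT, funext fun i => ?_⟩
    by_cases hi : i ∈ letters a
    · exact hTw i hi
    · rw [not_not.1 (mt mem_of_parity_ne_zero fun h => hi (hTsub h)),
        not_not.1 (mt mem_of_parity_ne_zero fun h => hi (hw.subset h))]

instance (n : ℕ) (α : List ℕ) : Decidable (IsBasisIndex n α) :=
  inferInstanceAs (Decidable (_ ∧ _))

lemma isMaximalCode_extraP (ha : a < 8) : IsMaximalCode (-1) a (extraP 0 a) := by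
  apply IsMaximalCode.of_mem_sublists <;> revert a <;> decide +kernel

lemma isMaximalCode_extraQ (ha : a < 8) : IsMaximalCode 1 a (extraQ 0 a) := by
  apply IsMaximalCode.of_mem_sublists <;> revert a <;> decide +kernel

lemma extraP_eq_map (m a : ℕ) : extraP m a = (extraP 0 a).map (List.map (m + ·)) := by
  unfold extraP; split <;> simp

lemma extraQ_eq_map (m a : ℕ) : extraQ m a = (extraQ 0 a).map (List.map (m + ·)) := by
  unfold extraQ; split <;> simp

end Assembly

section Tables

variable {p q m a : ℕ} {ε : ℤˣ} {K E : List (List ℕ)} {U : Set ℕ}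

/-- The words of the family index basis vectors of `Cl_{p,q}` that are independent commuting
involutions, and the family cannot be enlarged. -/
structure IsCompleteFamily (p q : ℕ) (L : List (List ℕ)) : Prop where
  basisIndex : ∀ α ∈ L, IsBasisIndex (p + q) α
  involutions : IsCommutingInvolutions (L.map (gammaMono p q))
  independent : IsIndependent L
  maximal : IsMaximal p q (letters (p + q)) L

lemma IsMaximalCode.isMaximal_map_add (hE : IsMaximalCode ε a E) (hm : m + a ≤ p + q)
    (hε : ∀ i ∈ List.range' (m + 1) a, genSign p i = ε) :
    IsMaximal p q (List.range' (m + 1) a) (E.map (List.map (m + ·))) := by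
  have hletters : List.range' (m + 1) a = (letters a).map (m + ·) := (List.map_add_range' ..).symm
  have hsub : List.range' (m + 1) a ⊆ letters (p + q) := fun i hi => by
    rw [List.mem_range'_1] at hi ⊢
    omega
  intro β hβ hβE
  obtain ⟨w', hw', hpar⟩ := exists_sublist_parity_eq (l := List.range' (m + 1) a)
    List.nodup_range' (v := parity β) fun i hi => hβ (mem_of_parity_ne_zero hi)
  have hw'sub : w' ⊆ letters (p + q) := List.Subset.trans hw'.subset hsub
  have hw'E := hβE.of_parity_eq (List.Subset.trans hβ hsub) hw'sub hpar
  have hsign := (gammaMono_mul_self_eq_one_iff hw'sub (hw'.nodup List.nodup_range')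
    fun i hi => hε i (hw'.subset hi)).1 hw'E.mul_self
  obtain ⟨w, hw, rfl⟩ := List.sublist_map_iff.1 (hletters ▸ hw')
  obtain ⟨T, hT, hTw⟩ := hE.maximal w hw (fun α hα => by
    have hαsub := ((hE.basisIndex α hα).map_add hm).subset_letters
    rw [← crossings_map (add_right_injective m), ← commute_gammaMono_iff hαsub hw'sub]
    exact hw'E.commute _ (List.mem_map_of_mem hα)) (by rwa [List.length_map] at hsign)
  refine ⟨T.map (List.map (m + ·)), hT.map _, ?_⟩
  rw [← List.map_flatten, parity_map_eq_parity_map (add_right_injective m) hTw, hpar]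

lemma IsSelfDualBlock.even_crossings_append (hK : IsSelfDualBlock K U)
    (hE : ∀ α ∈ E, ∀ β ∈ E, Even (crossings α β)) (hKE : ∀ α ∈ K, ∀ β ∈ E, α.Disjoint β) :
    ∀ α ∈ K ++ E, ∀ β ∈ K ++ E, Even (crossings α β) := by
  simp only [List.forall_mem_append]
  refine ⟨fun α hα => ⟨fun β hβ => ?_, fun β hβ => ?_⟩, fun α hα => ⟨fun β hβ => ?_, hE α hα⟩⟩
  · exact ((hK.even_length α hα).mul_right _).add (hK.even_coincidences α hα β hβ)
  · rw [crossings, coincidences_eq_zero_of_disjoint (hKE α hα β hβ)]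
    exact (hK.even_length α hα).mul_right _
  · rw [crossings, coincidences_eq_zero_of_disjoint (hKE β hβ α hα).symm]
    exact (hK.even_length β hβ).mul_left _

lemma IsCompleteFamily.of_append (hK : IsSelfDualBlock K U)
    (hKbasis : ∀ α ∈ K, IsBasisIndex (p + q) α)
    (hKsq : ∀ α ∈ K, gammaMono p q α * gammaMono p q α = 1) (hE : IsMaximalCode ε a E)
    (hm : m + a ≤ p + q) (hε : ∀ i ∈ List.range' (m + 1) a, genSign p i = ε)
    (hU : ∀ i ∈ letters (p + q), i ∈ U ↔ i ∉ List.range' (m + 1) a) :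
    IsCompleteFamily p q (K ++ E.map (List.map (m + ·))) := by
  have hinj := add_right_injective m
  have hEbasis : ∀ α ∈ E.map (List.map (m + ·)), IsBasisIndex (p + q) α :=
    List.forall_mem_map.2 fun α hα => (hE.basisIndex α hα).map_add hm
  have hEmem : ∀ α ∈ E.map (List.map (m + ·)), ∀ i ∈ α, i ∈ List.range' (m + 1) a := by
    simp only [List.forall_mem_map, List.mem_range'_1]
    intro α hα i hi
    have := (hE.basisIndex α hα).2.1 i hi
    omega
  have hEsq : ∀ α ∈ E.map (List.map (m + ·)), gammaMono p q α * gammaMono p q α = 1 := by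
    intro α hα
    rw [gammaMono_mul_self_eq_one_iff (hEbasis α hα).subset_letters (hEbasis α hα).nodup
      fun i hi => hε i (hEmem α hα i hi)]
    obtain ⟨δ, hδ, rfl⟩ := List.mem_map.1 hα
    rw [List.length_map, hE.squareSign_length δ hδ]
  have hdisj : ∀ α ∈ K, ∀ β ∈ E.map (List.map (m + ·)), α.Disjoint β :=
    fun α hα β hβ i hi hi' =>
      (hU i ((hKbasis α hα).subset_letters hi)).1 (hK.mem α hα i hi) (hEmem β hβ i hi')
  have hcross := hK.even_crossings_append (E := E.map (List.map (m + ·)))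
    (by simpa only [List.forall_mem_map, crossings_map hinj] using hE.even_crossings) hdisj
  have hbasis := List.forall_mem_append.2 ⟨hKbasis, hEbasis⟩
  have hinv : IsCommutingInvolutions ((K ++ E.map (List.map (m + ·))).map (gammaMono p q)) := by
    refine ⟨List.forall_mem_map.2 (List.forall_mem_append.2 ⟨hKsq, hEsq⟩), ?_⟩
    simp only [List.forall_mem_map]
    exact fun α hα β hβ => commute_gammaMono_of_even (hcross α hα β hβ)
  exact
    { basisIndex := hbasis
      involutions := hinv
      independent := hK.independent.append (hE.independent.map hinj) hdisj
      maximal := IsMaximal.append hK (hE.isMaximal_map_add hm hε)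
        (fun α hα => (hbasis α hα).subset_letters) hinv fun i hi => (hU i hi).2 }

lemma isBasisIndex_of_mem_pairs {s n : ℕ} (hms : m ≤ s) (hn : s + m ≤ n) :
    ∀ α ∈ pairs m s, IsBasisIndex n α := by
  simp only [pairs, List.forall_mem_map, List.mem_range]
  intro i hi
  refine ⟨List.pairwise_pair.2 (by omega), List.forall_mem_cons.2
    ⟨by omega, List.forall_mem_singleton.2 (by omega)⟩, by simp, by simp⟩

lemma isBasisIndex_of_mem_quads {s l n : ℕ} (hn : s + 8 * l ≤ n) :
    ∀ α ∈ quads s l, IsBasisIndex n α := by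
  have hoctet : ∀ α ∈ octet, IsBasisIndex 8 α := by decide
  induction l with
  | zero => simp [quads]
  | succ l ih =>
    rw [quads_succ]
    exact List.forall_mem_append.2 ⟨ih (by omega),
      List.forall_mem_map.2 fun α hα => (hoctet α hα).map_add (by omega)⟩

lemma gammaMono_mul_self_of_mem_pairs (hm : m ≤ p) (hn : m ≤ q) :
    ∀ α ∈ pairs m p, gammaMono p q α * gammaMono p q α = 1 := by
  intro α hα
  have hbasis := isBasisIndex_of_mem_pairs hm (Nat.add_le_add_left hn p) α hα
  rw [gammaMono_mul_self_of_nodup hbasis.subset_letters hbasis.nodup]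
  simp only [pairs, List.mem_map, List.mem_range] at hα
  obtain ⟨i, hi, rfl⟩ := hα
  simp [genSign, show i + 1 ≤ p by omega]

lemma gammaMono_mul_self_of_mem_quads {s l : ℕ} (hn : s + 8 * l ≤ p + q)
    (hε : ∀ i, s < i → i ≤ s + 8 * l → genSign p i = ε) :
    ∀ α ∈ quads s l, gammaMono p q α * gammaMono p q α = 1 := by
  intro α hα
  have hbasis := isBasisIndex_of_mem_quads hn α hα
  have hlength : α.length = 4 := by
    simp only [quads, List.mem_flatMap] at hα
    obtain ⟨i, -, hα⟩ := hα
    fin_cases hα <;> rfl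
  rw [gammaMono_mul_self_eq_one_iff hbasis.subset_letters hbasis.nodup fun i hi =>
    have hU := (isSelfDualBlock_quads s l).mem α hα i hi
    hε i hU.1 hU.2, hlength]
  exact (by decide : ∀ ε : ℤˣ, squareSign ε 4 = 1) ε

/- Both tables pair off positive with negative generators, which leaves a block of `8l + a`
consecutive generators of equal square. -/
lemma isCompleteFamily_pairs_append_quads_append {l t : ℕ} (hm : m ≤ p) (hmq : m ≤ q)
    (hE : IsMaximalCode ε a E) (ht : t + 8 * l + a ≤ p + q)
    (hε : ∀ i, t < i → i ≤ t + 8 * l + a → genSign p i = ε)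
    (hU : ∀ i, 1 ≤ i → i ≤ p + q →
      (i ≤ m ∨ p < i ∧ i ≤ p + m ↔ i ≤ t ∨ t + 8 * l + a < i)) :
    IsCompleteFamily p q (pairs m p ++ quads t l ++ E.map (List.map (t + 8 * l + ·))) := by
  refine .of_append ((isSelfDualBlock_pairs hm).append (isSelfDualBlock_quads t l) ?_)
    (List.forall_mem_append.2 ⟨isBasisIndex_of_mem_pairs hm (by omega),
      isBasisIndex_of_mem_quads (by omega)⟩)
    (List.forall_mem_append.2 ⟨gammaMono_mul_self_of_mem_pairs hm hmq,
      gammaMono_mul_self_of_mem_quads (by omega) fun i h₁ h₂ => hε i h₁ (by omega)⟩) hE ht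
    (fun i hi => ?_) fun i hi => ?_
  · simp only [Set.disjoint_left, Set.mem_union, Set.mem_Icc]
    intro i hi hi'
    have := hU i
    omega
  · rw [List.mem_range'_1] at hi
    exact hε i (by omega) (by omega)
  · have := hU i
    simp only [List.mem_range'_1, Set.mem_union, Set.mem_Icc] at hi ⊢
    omega

lemma isCompleteFamily_tableP (p l : ℕ) (ha : a < 8) :
    IsCompleteFamily p (p + 8 * l + a) (tableP p l a) := by
  rw [tableP, P2, P4, extraP_eq_map]
  refine isCompleteFamily_pairs_append_quads_append (ε := -1) le_rfl (by omega)
    (isMaximalCode_extraP ha) (by omega) (fun i hi _ => if_neg (by omega)) (by omega)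

lemma isCompleteFamily_tableQ (q l : ℕ) (ha : a < 8) :
    IsCompleteFamily (q + 8 * l + a) q (tableQ q l a) := by
  rw [tableQ, Q2, Q4, extraQ_eq_map]
  refine isCompleteFamily_pairs_append_quads_append (ε := 1) (by omega) le_rfl
    (isMaximalCode_extraQ ha) (by omega) (fun i _ hi => if_pos (by omega)) (by omega)

end Tables

section Counting

lemma length_pairs (m s : ℕ) : (pairs m s).length = m := by simp [pairs]

lemma length_quads (s l : ℕ) : (quads s l).length = 4 * l := by
  simp [quads, mul_comm]

lemma length_tableP (p l : ℕ) {a : ℕ} (ha : a < 8) : (tableP p l a).length = kP p l a := by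
  rw [tableP, List.length_append, List.length_append, P2, P4, length_pairs, length_quads]
  interval_cases a <;> rfl

lemma length_tableQ (q l : ℕ) {a : ℕ} (ha : a < 8) : (tableQ q l a).length = kQ q l a := by
  rw [tableQ, List.length_append, List.length_append, Q2, Q4, length_pairs, length_quads]
  interval_cases a <;> rfl

lemma radonHurwitzNat_add (l a : ℕ) :
    radonHurwitzNat (8 * l + a) = radonHurwitzNat a + 4 * l := by
  induction l with
  | zero => simp
  | succ l ih =>
    rw [show 8 * (l + 1) + a = 8 * l + a + 8 by ring, radonHurwitzNat, ih]
    push_cast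
    ring

lemma radonHurwitz_natCast (i : ℕ) : radonHurwitz i = radonHurwitzNat i := rfl

lemma radonHurwitz_neg_natCast_add_two (i : ℕ) :
    radonHurwitz (-((i + 2 : ℕ) : ℤ)) = radonHurwitzNat i - i - 1 := by
  rw [show -((i + 2 : ℕ) : ℤ) = Int.negSucc (i + 1) by rw [Int.negSucc_eq]; push_cast; ring,
    radonHurwitz]
  ring

lemma radonHurwitz_neg_natCast_add_eight (i : ℕ) :
    radonHurwitz (-((i + 8 : ℕ) : ℤ)) = radonHurwitz (-(i : ℤ)) - 4 := by
  match i with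
  | 0 => rfl
  | 1 => rfl
  | i + 2 =>
    rw [add_right_comm, radonHurwitz_neg_natCast_add_two, radonHurwitz_neg_natCast_add_two,
      radonHurwitzNat]
    push_cast
    ring

lemma radonHurwitz_neg_natCast_add (l a : ℕ) :
    radonHurwitz (-((8 * l + a : ℕ) : ℤ)) = radonHurwitz (-(a : ℤ)) - 4 * l := by
  induction l with
  | zero => simp
  | succ l ih =>
    rw [show 8 * (l + 1) + a = 8 * l + a + 8 by ring, radonHurwitz_neg_natCast_add_eight, ih]
    push_cast
    ring

lemma kP_eq (p l : ℕ) {a : ℕ} (ha : a < 8) :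
    (kP p l a : ℤ) = ((p + 8 * l + a : ℕ) : ℤ) -
      radonHurwitz (((p + 8 * l + a : ℕ) : ℤ) - (p : ℤ)) := by
  rw [show ((p + 8 * l + a : ℕ) : ℤ) - (p : ℤ) = ((8 * l + a : ℕ) : ℤ) by push_cast; ring,
    radonHurwitz_natCast, radonHurwitzNat_add]
  interval_cases a <;> simp [kP, radonHurwitzNat] <;> ring

lemma kQ_eq (q l : ℕ) {a : ℕ} (ha : a < 8) :
    (kQ q l a : ℤ) = (q : ℤ) - radonHurwitz ((q : ℤ) - ((q + 8 * l + a : ℕ) : ℤ)) := by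
  rw [show (q : ℤ) - ((q + 8 * l + a : ℕ) : ℤ) = -((8 * l + a : ℕ) : ℤ) by push_cast; ring,
    radonHurwitz_neg_natCast_add]
  have hbase : radonHurwitz (-(a : ℤ)) = -(kQ 0 0 a : ℤ) := by interval_cases a <;> rfl
  have hkQ : kQ q l a = kQ 0 0 a + q + 4 * l := by interval_cases a <;> simp only [kQ] <;> ring
  rw [hbase, hkQ]
  push_cast
  ring

lemma exists_eq_add_eight_mul_add {m n : ℕ} (h : m ≤ n) :
    ∃ l a : ℕ, a < 8 ∧ n = m + 8 * l + a :=
  ⟨(n - m) / 8, (n - m) % 8, by omega, by omega⟩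

end Counting

namespace IsCompleteFamily

variable {p q : ℕ} {L : List (List ℕ)}

lemma subset_letters (h : IsCompleteFamily p q L) : ∀ α ∈ L, α ⊆ letters (p + q) :=
  fun α hα => (h.basisIndex α hα).subset_letters

lemma isGeneratingSet (h : IsCompleteFamily p q L)
    (hlength : (L.length : ℤ) = q - radonHurwitz ((q : ℤ) - p)) :
    IsGeneratingSet p q (gammaSet p q L) where
  finite := L.finite_toSet.image (gammaMono p q)
  card := by rw [ncard_gammaSet h.subset_letters h.independent, hlength]
  involution := by
    rintro _ ⟨α, hα, rfl⟩
    exact h.involutions.mul_self _ (List.mem_map_of_mem hα)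
  commute := by
    rintro _ ⟨α, hα, rfl⟩ _ ⟨β, hβ, rfl⟩
    exact (h.involutions.commute _ (List.mem_map_of_mem hα) _ (List.mem_map_of_mem hβ)).eq
  independent := by
    rintro _ ⟨α, hα, rfl⟩
    exact gammaMono_notMem_closure h.subset_letters h.involutions h.independent hα

lemma isAtom_leftIdeal (h : IsCompleteFamily p q L) : IsAtom (leftIdeal (idem p q L)) :=
  isAtom_leftIdeal_idem h.subset_letters h.involutions h.independent h.maximal

lemma isPrimitiveIdempotent (h : IsCompleteFamily p q L) :
    IsPrimitiveIdempotent (idem p q L) :=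
  isPrimitiveIdempotent_of_isAtom_leftIdeal (isIdempotentElem_idem h.involutions)
    h.isAtom_leftIdeal

end IsCompleteFamily

end CliffordTables

end

open CliffordTables in
theorem mainTheorem1 :
    -- every signature is of one of the two forms
    (∀ p q : ℕ, (∃ l a : ℕ, a < 8 ∧ q = p + 8 * l + a) ∨ (∃ l a : ℕ, a < 8 ∧ p = q + 8 * l + a)) ∧
    -- signatures `(p, p + 8l + a)`
    (∀ p l a : ℕ, a < 8 →
      (∀ α ∈ tableP p l a, IsBasisIndex (p + (p + 8 * l + a)) α) ∧
      IsGeneratingSet p (p + 8 * l + a) (gammaSet p (p + 8 * l + a) (tableP p l a)) ∧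
      (gammaSet p (p + 8 * l + a) (tableP p l a)).ncard = kP p l a ∧
      (tableP p l a).length = kP p l a ∧
      IsPrimitiveIdempotent (idem p (p + 8 * l + a) (tableP p l a)) ∧
      IsAtom (leftIdeal (idem p (p + 8 * l + a) (tableP p l a))) ∧
      kP p l a ≤ p + (p + 8 * l + a) ∧
      Module.finrank ℝ (leftIdeal (idem p (p + 8 * l + a) (tableP p l a))) =
        2 ^ (p + (p + 8 * l + a) - kP p l a)) ∧
    -- signatures `(q + 8l + a, q)`
    (∀ q l a : ℕ, a < 8 →
      (∀ α ∈ tableQ q l a, IsBasisIndex (q + 8 * l + a + q) α) ∧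
      IsGeneratingSet (q + 8 * l + a) q (gammaSet (q + 8 * l + a) q (tableQ q l a)) ∧
      (gammaSet (q + 8 * l + a) q (tableQ q l a)).ncard = kQ q l a ∧
      (tableQ q l a).length = kQ q l a ∧
      IsPrimitiveIdempotent (idem (q + 8 * l + a) q (tableQ q l a)) ∧
      IsAtom (leftIdeal (idem (q + 8 * l + a) q (tableQ q l a))) ∧
      kQ q l a ≤ q + 8 * l + a + q ∧
      Module.finrank ℝ (leftIdeal (idem (q + 8 * l + a) q (tableQ q l a))) =
        2 ^ (q + 8 * l + a + q - kQ q l a)) := by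
  refine ⟨fun p q => (le_total p q).imp exists_eq_add_eight_mul_add exists_eq_add_eight_mul_add,
    fun p l a ha => ?_, fun q l a ha => ?_⟩
  · have h := isCompleteFamily_tableP p l ha
    rw [← length_tableP p l ha]
    exact ⟨h.basisIndex, h.isGeneratingSet (by rw [length_tableP p l ha, kP_eq p l ha]),
      ncard_gammaSet h.subset_letters h.independent, rfl, h.isPrimitiveIdempotent,
      h.isAtom_leftIdeal, length_le_of_isIndependent h.subset_letters h.involutions h.independent,
      finrank_leftIdeal_idem h.subset_letters h.involutions h.independent⟩
  · have h := isCompleteFamily_tableQ q l ha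
    rw [← length_tableQ q l ha]
    exact ⟨h.basisIndex, h.isGeneratingSet (by rw [length_tableQ q l ha, kQ_eq q l ha]),
      ncard_gammaSet h.subset_letters h.independent, rfl, h.isPrimitiveIdempotent,
      h.isAtom_leftIdeal, length_le_of_isIndependent h.subset_letters h.involutions h.independent,
      finrank_leftIdeal_idem h.subset_letters h.involutions h.independent⟩
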